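/- **Setting.** Let $m\ge 2$, let $\mathcal K\subseteq\mathbb R^d$ be nonempty, closed and convex, $\mathcal O\supseteq\mathcal K$ open, let $f_1,\dots,f_m:\mathcal O\to\mathbb R$ be convex and twice differentiable, $G:\mathcal K\to\mathbb R$ convex, $F=\frac1m\sum_{i=1}^m f_i$, $U=F+G$, $U^\star=\inf_{\mathcal K}U$. Assume $\mu I\preceq\nabla^2F(x)\preceq LI$ and $\nabla^2 f_i(x)\preceq L_iI$ on $\mathcal K$, with $\mu,L,L_i>0$. *Surrogates.* For each $i$ let $\tilde f_i:\mathcal O\times\mathcal O\to\mathbb R$, $(x,z)\mapsto\tilde f_i(x;z)$, be $C^2$ such that, for all $x,z\in\mathcal K$ (with $\nabla,\nabla^2$ taken in the first argument): $\nabla\tilde f_i(x;x)=\nabla f_i(x)$; $\nabla\tilde f_i(\cdot\,;z)$ is $\tilde L_i$-Lipschitz on $\mathcal K$; $\tilde f_i(\cdot\,;z)$ is $\tilde\mu_i$-strongly convex on $\mathcal K$, $\tilde\mu_i>0$; and $D_i^\ell I\preceq\nabla^2\tilde f_i(x;z)-\nabla^2F(x)\preceq D_i^uI$, with constants $D_i^\ell\le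 D_i^u$. Put $L_{\max}=\max_iL_i$, $\tilde\mu_{\min}=\min_i\tilde\mu_i$, $D^\ell_{\min}=\min_iD_i^\ell$, $D_{\max}=\max_i\max\{|D_i^\ell|,|D_i^u|\}$, and assume $\tilde\mu_{\min}\ge D_{\min}^\ell$. *Network.* Let $\mathcal G^\nu=(\{1,\dots,m\},\mathcal E^\nu)$, $\nu\ge0$, be digraphs and $B\ge1$ an integer such that the graph with edge set $\bigcup_{t=\nu B}^{(\nu+1)B-1}\mathcal E^t$ is strongly connected for every $\nu\ge 0$. Let $C^\nu=(c^\nu_{ij})$ be column stochastic matrices and $c_\ell>0$ such that $c_{ii}^\nu\ge c_\ell$ and, for $i\neq j$, $c_{ij}^\nu\ge c_\ell$ if $(j,i)\in\mathcal E^\nu$ and $c_{ij}^\nu=0$ otherwise. *Algorithm (SONATA).* Start from $x_i^0\in\mathcal K$, $y_i^0=\nabla f_i(x_i^0)$, $\phi_i^0=1$ and iterate, for $\nu=0,1,\dots$, $$\hat x_i^\nu\in\operatorname*{argmin}_{w\in\mathcal K}\ \tilde f_i(w;x_i^\nu)+(y_i^\nu-\nabla f_i(x_i^\nu))^\top(w-x_i^\nu)+G(w),\qquad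 x_i^{\nu+\frac12}=x_i^\nu+\alpha(\hat x_i^\nu-x_i^\nu),$$ $$\phi_i^{\nu+1}=\sum_jc_{ij}^\nu\phi_j^\nu,\qquad x_i^{\nu+1}=\frac1{\phi_i^{\nu+1}}\sum_jc_{ij}^\nu\phi_j^\nu x_j^{\nu+\frac12},$$ $$y_i^{\nu+1}=\frac1{\phi_i^{\nu+1}}\sum_jc_{ij}^\nu\big(\phi_j^\nu y_j^\nu+\nabla f_j(x_j^{\nu+1})-\nabla f_j(x_j^\nu)\big).$$ *Constants.* Let $\phi_{lb}=c_\ell^{2(m-1)B}$, $\phi_{ub}=m-c_\ell^{2(m-1)B}$, $\tilde c_\ell=c_\ell^{2(m-1)B+1}/m$, $$c_0=2m\,\frac{1+\tilde c_\ell^{-(m-1)B}}{1-\tilde c_\ell^{-(m-1)B}}\ \text{ (only even powers of $c_0$ are used)},\qquad\rho_B=\big(1-\tilde c_\ell^{(m-1)B}\big)^{\frac1{(m-1)B}},$$ $$C_1=\frac6{\mu\phi_{lb}}\Big(\big(\tfrac{D_{\max}}{\tilde\mu_{\min}}+1\big)^2+\frac{4L_{\max}^2}{\tilde\mu_{\min}^2}\Big),\qquad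 C_2=\frac4{\tilde\mu_{\min}^2},$$ $$G_P^\star(a)=\frac{\frac{D_{\max}^2}\mu+\frac1\mu\big((1-\frac a2)\tilde\mu_{\min}+\frac{D^\ell_{\min}}2a\big)^2}{\big((1-\frac a2)\tilde\mu_{\min}+\frac{D^\ell_{\min}}2a\big)^2},\qquad\bar G=G_P^\star\Big(\frac{\tilde\mu_{\min}}{\tilde\mu_{\min}-D^\ell_{\min}}\Big)$$ ($G_P^\star$ is constant, and $\bar G$ is its value, if $D^\ell_{\min}=\tilde\mu_{\min}$), and for $\theta\in(0,1)$ $$A_{1,\theta}=\bar G\,\theta^{-1}C_1\cdot8\phi_{ub}L_{\max}^2\cdot\frac{2c_0^2\rho_B^2}{1-\rho_B},\qquad A_{2,\theta}=\big(\bar G\,\theta^{-1}2\phi_{ub}C_1+C_2\big)\cdot2m\phi_{lb}^{-2}L_{\max}^2\cdot\frac{2c_0^2\rho_B^2}{1-\rho_B},$$ $$A_{3,\theta}=\big(\bar G\,\theta^{-1}2\phi_{ub}C_1+C_2\big)\cdot8m\phi_{lb}^{-2}L_{\max}^2\cdot\frac{4c_0^4\rho_B^4}{(1-\rho_B)^2},\qquad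 A_\theta=\sqrt{A_{1,\theta}+A_{2,\theta}+A_{3,\theta}},$$ $$J=\frac12\cdot\frac{\tilde\mu_{\min}\mu}{4D_{\max}^2+\tilde\mu_{\min}\mu},\qquad\alpha^*=\frac{1-\rho_B}{A_{1/2}+J},\qquad\alpha_{\max}=\min\Big\{\frac{1-\rho_B}{A_{1/2}},\ \frac{\tilde\mu_{\min}}{\tilde\mu_{\min}-D^\ell_{\min}},\ 1\Big\},$$ where the middle term is $+\infty$ if $D^\ell_{\min}=\tilde\mu_{\min}$. **Theorem.** If $\alpha\in(0,\alpha_{\max})$, then for every $i=1,\dots,m$ the sequence $U(x_i^\nu)$ converges to $U^\star$ R-linearly, with $U(x_i^\nu)-U^\star=\mathcal O(z^\nu)$ as $\nu\to\infty$, where $z\in(0,1)$ is given by $$z=\begin{cases}1-J\alpha,&\alpha\in(0,\min\{\alpha^*,\alpha_{\max}\}),\\ \rho_B+A_{1/2}\,\alpha,&\alpha\in[\min\{\alpha^*,\alpha_{\max}\},\alpha_{\max}).\end{cases}$$ -/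

import Mathlib

open Filter Asymptotics Topology
open scoped InnerProductSpace NNReal

namespace SONATA

/-- The space `ℝ^d` with the Euclidean norm. -/
abbrev Vec (d : ℕ) : Type := EuclideanSpace ℝ (Fin d)

/-- The Hessian of `g` at `x`, i.e. the derivative of the gradient map. -/
noncomputable def hess {d : ℕ} (g : Vec d → ℝ) (x : Vec d) : Vec d →L[ℝ] Vec d :=
  fderiv ℝ (gradient g) x

/-- `a I ⪯ M` in terms of quadratic forms. -/
def LowerBd {d : ℕ} (a : ℝ) (M : Vec d →L[ℝ] Vec d) : Prop :=
  ∀ v : Vec d, a * ‖v‖ ^ 2 ≤ ⟪v, M v⟫_ℝ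

/-- `M ⪯ b I` in terms of quadratic forms. -/
def UpperBd {d : ℕ} (M : Vec d →L[ℝ] Vec d) (b : ℝ) : Prop :=
  ∀ v : Vec d, ⟪v, M v⟫_ℝ ≤ b * ‖v‖ ^ 2

/-! ### The optimization problem -/

/-- Data of the problem `min_{x ∈ K} U(x) = F(x) + G(x)`, `F = (1/m) ∑ f_i`.  The values of the
`f i` off `O` and those of `G` off `K` play no role. -/
structure Problem (m d : ℕ) where
  /-- the open set on which the losses are defined -/
  O : Set (Vec d)
  /-- the constraint set -/
  K : Set (Vec d)
  /-- the loss of each agent -/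
  f : Fin m → Vec d → ℝ
  /-- the nonsmooth term -/
  G : Vec d → ℝ

namespace Problem

variable {m d : ℕ} (P : Problem m d)

/-- `F = (1/m) ∑ f_i`. -/
noncomputable def F (x : Vec d) : ℝ := (1 / (m : ℝ)) * ∑ i, P.f i x

/-- The objective `U = F + G`. -/
noncomputable def U (x : Vec d) : ℝ := P.F x + P.G x

/-- The optimal value `U⋆` of the problem. -/
noncomputable def Ustar : ℝ := sInf (P.U '' P.K)

/-- Standing assumptions on the problem, with strong convexity and smoothness constants
`μ`, `L` of `F` on `K`. -/
structure Regular (μ L : ℝ) : Prop where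
  K_nonempty : P.K.Nonempty
  K_closed : IsClosed P.K
  K_convex : Convex ℝ P.K
  O_open : IsOpen P.O
  K_subset_O : P.K ⊆ P.O
  f_diff : ∀ i, DifferentiableOn ℝ (P.f i) P.O
  f_diff_two : ∀ i, DifferentiableOn ℝ (gradient (P.f i)) P.O
  f_convex : ∀ i, ConvexOn ℝ P.O (P.f i)
  mu_pos : 0 < μ
  L_pos : 0 < L
  F_lower : ∀ x ∈ P.K, LowerBd μ (hess P.F x)
  F_upper : ∀ x ∈ P.K, UpperBd (hess P.F x) L
  G_convex : ConvexOn ℝ P.K P.G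

/-- `Ls i` is a smoothness constant of `f i` on `K`: `∇²f_i(x) ⪯ L_i I` for `x ∈ K`. -/
def SmoothConsts (Ls : Fin m → ℝ) : Prop :=
  ∀ i, 0 < Ls i ∧ ∀ x ∈ P.K, UpperBd (hess (P.f i) x) (Ls i)

/-- Assumptions on the surrogates: `ft i x z` is `f̃_i(x ; z)`; the surrogate is `C²`, its partial
gradient in the first argument agrees with that of `f_i` on the diagonal of `K`, is
`Lt i`-Lipschitz on `K`, and `f̃_i(· ; z)` is `mus i`-strongly convex on `K`. -/
structure Surrogate (ft : Fin m → Vec d → Vec d → ℝ) (Lt : Fin m → ℝ≥0) (mus : Fin m → ℝ) :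
    Prop where
  smooth : ∀ i, ContDiffOn ℝ 2 (fun q : Vec d × Vec d => ft i q.1 q.2) (P.O ×ˢ P.O)
  grad_diag : ∀ i, ∀ x ∈ P.K, gradient (fun w => ft i w x) x = gradient (P.f i) x
  lipschitz : ∀ i, ∀ z ∈ P.K, LipschitzOnWith (Lt i) (gradient fun w => ft i w z) P.K
  mus_pos : ∀ i, 0 < mus i
  strong : ∀ i, ∀ z ∈ P.K, StrongConvexOn P.K (mus i) (fun w => ft i w z)

/-- `D_i^ℓ I ⪯ ∇²f̃_i(x ; z) - ∇²F(x) ⪯ D_i^u I` for all `x, z ∈ K`. -/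
def HessGap (ft : Fin m → Vec d → Vec d → ℝ) (Dl Du : Fin m → ℝ) : Prop :=
  ∀ i, Dl i ≤ Du i ∧ ∀ x ∈ P.K, ∀ z ∈ P.K,
    LowerBd (Dl i) (hess (fun w => ft i w z) x - hess P.F x) ∧
    UpperBd (hess (fun w => ft i w z) x - hess P.F x) (Du i)

end Problem

/-! ### The network -/

/-- `E t a b` says that at time `t` there is a link from `a` to `b`.  The sequence is
`B`-strongly connected: over each window `[kB, (k+1)B)` the union graph is strongly connected. -/
def StronglyConnected {m : ℕ} (E : ℕ → Fin m → Fin m → Prop) (B : ℕ) : Prop :=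
  0 < B ∧ ∀ (k : ℕ) (a b : Fin m),
    Relation.ReflTransGen
      (fun u v => ∃ t, k * B ≤ t ∧ t < (k + 1) * B ∧ E t u v) a b

/-- The weight matrices comply with the digraphs, with lower bound `cl`, and are column
stochastic. -/
structure Weights {m : ℕ} (E : ℕ → Fin m → Fin m → Prop) (C : ℕ → Matrix (Fin m) (Fin m) ℝ)
    (cl : ℝ) : Prop where
  cl_pos : 0 < cl
  diag : ∀ t i, cl ≤ C t i i
  edge : ∀ t i j, i ≠ j → E t j i → cl ≤ C t i j
  nonedge : ∀ t i j, i ≠ j → ¬ E t j i → C t i j = 0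
  col_sum : ∀ t j, ∑ i, C t i j = 1

/-! ### The algorithm -/

/-- The sequences produced by the algorithm; `x ν i` is `x_i^ν`, and so on. -/
structure Trajectory (m d : ℕ) where
  x : ℕ → Fin m → Vec d
  xhat : ℕ → Fin m → Vec d
  xhalf : ℕ → Fin m → Vec d
  y : ℕ → Fin m → Vec d
  phi : ℕ → Fin m → ℝ

/-- `T` is a run of SONATA over the time-varying digraph with weights `C`, surrogates `ft` and
step-size `α`. -/
structure IsRun {m d : ℕ} (P : Problem m d) (ft : Fin m → Vec d → Vec d → ℝ)
    (C : ℕ → Matrix (Fin m) (Fin m) ℝ) (α : ℝ) (T : Trajectory m d) : Prop where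
  x_init : ∀ i, T.x 0 i ∈ P.K
  y_init : ∀ i, T.y 0 i = gradient (P.f i) (T.x 0 i)
  phi_init : ∀ i, T.phi 0 i = 1
  xhat_mem : ∀ ν i, T.xhat ν i ∈ P.K
  xhat_min : ∀ ν i, IsMinOn
    (fun w => ft i w (T.x ν i)
      + ⟪T.y ν i - gradient (P.f i) (T.x ν i), w - T.x ν i⟫_ℝ + P.G w) P.K (T.xhat ν i)
  xhalf_eq : ∀ ν i, T.xhalf ν i = T.x ν i + α • (T.xhat ν i - T.x ν i)
  phi_succ : ∀ ν i, T.phi (ν + 1) i = ∑ j, C ν i j * T.phi ν j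
  x_succ : ∀ ν i, T.x (ν + 1) i =
    (1 / T.phi (ν + 1) i) • ∑ j, (C ν i j * T.phi ν j) • T.xhalf ν j
  y_succ : ∀ ν i, T.y (ν + 1) i =
    (1 / T.phi (ν + 1) i) • ∑ j, C ν i j •
      (T.phi ν j • T.y ν j
        + (gradient (P.f j) (T.x (ν + 1) j) - gradient (P.f j) (T.x ν j)))

/-! ### The constants in the rate -/

/-- The primitive constants on which the rate depends: the strong convexity constant `mu` of `F`,
the network constants `cl`, `B`, and per agent the constants `L_i`, `μ̃_i`, `D_i^ℓ`, `D_i^u`. -/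
structure Consts (m : ℕ) where
  mu : ℝ
  cl : ℝ
  B : ℕ
  Ls : Fin m → ℝ
  mus : Fin m → ℝ
  Dl : Fin m → ℝ
  Du : Fin m → ℝ

namespace Consts

variable {m : ℕ} (c : Consts m)

/-- `L_max = max_i L_i`. -/
noncomputable def Lmax : ℝ := ⨆ i, c.Ls i

/-- `μ̃_min = min_i μ̃_i`. -/
noncomputable def musMin : ℝ := ⨅ i, c.mus i

/-- `D_min^ℓ = min_i D_i^ℓ`. -/
noncomputable def DlMin : ℝ := ⨅ i, c.Dl i

/-- `D_max = max_i D_i` with `D_i = max {|D_i^ℓ|, |D_i^u|}`. -/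
noncomputable def Dmax : ℝ := ⨆ i, max |c.Dl i| |c.Du i|

/-- `φ_lb = c_ℓ^{2(m-1)B}`. -/
noncomputable def philb : ℝ := c.cl ^ (2 * (m - 1) * c.B)

/-- `φ_ub = m - c_ℓ^{2(m-1)B}`. -/
noncomputable def phiub : ℝ := (m : ℝ) - c.cl ^ (2 * (m - 1) * c.B)

/-- `c̃_ℓ = c_ℓ^{2(m-1)B+1} / m`. -/
noncomputable def clt : ℝ := c.cl ^ (2 * (m - 1) * c.B + 1) / (m : ℝ)

/-- `c_0`; it enters the other constants only through even powers, so its sign is immaterial. -/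
noncomputable def c0 : ℝ :=
  2 * (m : ℝ) * ((1 + (c.clt ^ ((m - 1) * c.B))⁻¹) / (1 - (c.clt ^ ((m - 1) * c.B))⁻¹))

/-- `ρ_B = (1 - c̃_ℓ^{(m-1)B})^{1/((m-1)B)}`. -/
noncomputable def rhoB : ℝ :=
  (1 - c.clt ^ ((m - 1) * c.B)) ^ (1 / (((m - 1) * c.B : ℕ) : ℝ))

/-- `(1 - α/2) μ̃_min + (α/2) D_min^ℓ`. -/
noncomputable def curv (α : ℝ) : ℝ := (1 - α / 2) * c.musMin + c.DlMin / 2 * α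

/-- `G_P^⋆(α)`. -/
noncomputable def GP (α : ℝ) : ℝ :=
  (c.Dmax ^ 2 / c.mu + 1 / c.mu * c.curv α ^ 2) / c.curv α ^ 2

/-- `G_P^⋆(μ̃_min / (μ̃_min - D_min^ℓ))`.  If `D_min^ℓ = μ̃_min` the function `G_P^⋆` is constant, so
that the (conventional) value of the quotient does not matter. -/
noncomputable def GPcap : ℝ := c.GP (c.musMin / (c.musMin - c.DlMin))

noncomputable def C1 : ℝ :=
  6 / (c.mu * c.philb) * ((c.Dmax / c.musMin + 1) ^ 2 + 4 * c.Lmax ^ 2 / c.musMin ^ 2)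

noncomputable def C2 : ℝ := 4 / c.musMin ^ 2

noncomputable def A1 (θ : ℝ) : ℝ :=
  c.GPcap * θ⁻¹ * c.C1 * (8 * c.phiub * c.Lmax ^ 2)
    * (2 * c.c0 ^ 2 * c.rhoB ^ 2 / (1 - c.rhoB))

noncomputable def A2 (θ : ℝ) : ℝ :=
  (c.GPcap * θ⁻¹ * (2 * c.phiub) * c.C1 + c.C2) * (2 * (m : ℝ) * (c.philb ^ 2)⁻¹ * c.Lmax ^ 2)
    * (2 * c.c0 ^ 2 * c.rhoB ^ 2 / (1 - c.rhoB))

noncomputable def A3 (θ : ℝ) : ℝ :=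
  (c.GPcap * θ⁻¹ * (2 * c.phiub) * c.C1 + c.C2) * (8 * (m : ℝ) * (c.philb ^ 2)⁻¹ * c.Lmax ^ 2)
    * (4 * c.c0 ^ 4 * c.rhoB ^ 4 / (1 - c.rhoB) ^ 2)

/-- `A_θ`. -/
noncomputable def A (θ : ℝ) : ℝ := Real.sqrt (c.A1 θ + c.A2 θ + c.A3 θ)

/-- `J`. -/
noncomputable def J : ℝ :=
  c.musMin * c.mu / (4 * c.Dmax ^ 2 + c.musMin * c.mu) * (1 / 2)

/-- `α_max = min {(1-ρ_B)/A_{1/2}, μ̃_min/(μ̃_min - D_min^ℓ), 1}`, where the middle term is `+∞`, hence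
dropped, if `D_min^ℓ = μ̃_min`. -/
noncomputable def alphaMax : ℝ :=
  if c.DlMin < c.musMin then
    min ((1 - c.rhoB) / c.A (1 / 2)) (min (c.musMin / (c.musMin - c.DlMin)) 1)
  else min ((1 - c.rhoB) / c.A (1 / 2)) 1

/-- `α^* = (1-ρ_B)/(A_{1/2} + J)`. -/
noncomputable def alphaStar : ℝ := (1 - c.rhoB) / (c.A (1 / 2) + c.J)

/-- The rate `z` as a function of the step-size. -/
noncomputable def rate (α : ℝ) : ℝ :=
  if α < min c.alphaStar c.alphaMax then 1 - c.J * α else c.rhoB + c.A (1 / 2) * α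

end Consts

end SONATA

/-!
The proof combines a descent analysis of the local optimization steps with a consensus analysis of
the averaging steps, and closes the loop between the two by a small-gain argument.

*Optimization.*  At agent `i` let `e` be the direction `x̂ - x` and `δ = ∇F(x) - y` the error of the
gradient estimate.  The variational inequality of the subproblem gives a decrease of `U` by
`α (curv α) ‖e‖²` up to `α ‖δ‖ ‖e‖` (`descent_step`), while strong convexity of `F` bounds
`U(x̂) - U⋆` by `(D_max² ‖e‖² + ‖δ‖²) / μ` (`gap_step`).  Eliminating `‖e‖`
(`contraction_of_descent`), the gap contracts by `1 - α τ`, where `τ ≥ 2 J`, up to `α τ GP(α) ‖δ‖²`.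
As `G` need not be lower semicontinuous, `U` need not have a minimizer on `K`;
`exists_limit_minimizer` provides a limit of a minimizing sequence that serves in its place.

*Network.*  The row stochastic matrices `c_ij φ_j / φ_i⁺` that average the iterates have, over any
`m - 1` consecutive windows, products with entries bounded below (`Compatible.pow_le_backProd`), so
that diameters of families of vectors decay geometrically with ratio `ρ_B`
(`Compatible.spreadLE_backProd`).  `exists_consensus_bound` turns this into scalar recursions
`X⁺ ≤ ρ_B X + q ‖perturbation‖²`, valid at every single step, for majorants `X`, `Y` of the squared
disagreements of the iterates and of the gradient estimates.

*The loop.*  With `p = ∑ φ_i (U(x_i) - U⋆)` and `S = ∑ ‖x̂_i - x_i‖²`, the error `δ` is controlled by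
`X` and `Y`, the perturbations of `X` and `Y` by `S` and `X`, and `S ≤ C1 p + C2 Y`
(`IsRun.sum_norm_direction_sq_le`).  At `z ≥ max (1 - J α) (ρ_B + A α)` the loop gain is at most one,
because `A²` is at least the sum of the gains along the loops, and then `p = O(z^ν)` with the same `z`
(`geometric_of_small_gain`).
-/

namespace SONATA

/-! ### Products of stochastic matrices and consensus -/

section Mixing

variable {m : ℕ} {V : Type*} [NormedAddCommGroup V]

/-- The family `a` has diameter at most `r`. -/
def SpreadLE (a : Fin m → V) (r : ℝ) : Prop := ∀ i j, ‖a i - a j‖ ≤ r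

lemma SpreadLE.add {a b : Fin m → V} {r s : ℝ} (ha : SpreadLE a r) (hb : SpreadLE b s) :
    SpreadLE (a + b) (r + s) := fun i j => by
  rw [Pi.add_apply, Pi.add_apply, add_sub_add_comm]
  exact (norm_add_le _ _).trans (add_le_add (ha i j) (hb i j))

lemma SpreadLE.mono {a : Fin m → V} {r s : ℝ} (ha : SpreadLE a r) (h : r ≤ s) : SpreadLE a s :=
  fun i j => (ha i j).trans h

lemma spreadLE_sqrt (b : Fin m → V) : SpreadLE b (√(2 * ∑ i, ‖b i‖ ^ 2)) := by
  intro i j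
  refine Real.le_sqrt_of_sq_le ?_
  rcases eq_or_ne i j with rfl | hij
  · simp; positivity
  have h1 : ‖b i‖ ^ 2 + ‖b j‖ ^ 2 ≤ ∑ i, ‖b i‖ ^ 2 := by
    rw [← Finset.sum_pair hij (f := fun i => ‖b i‖ ^ 2)]
    exact Finset.sum_le_sum_of_subset_of_nonneg (Finset.subset_univ _) fun _ _ _ => by positivity
  have h2 := norm_sub_le (b i) (b j)
  nlinarith [norm_nonneg (b i - b j), sq_nonneg (‖b i‖ - ‖b j‖)]

variable [NormedSpace ℝ V]

/-- The averaging step `a ↦ (∑ⱼ Mᵢⱼ aⱼ)ᵢ` on families of vectors. -/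
def mix (M : Matrix (Fin m) (Fin m) ℝ) (a : Fin m → V) (i : Fin m) : V := ∑ j, M i j • a j

/-- The backward product `W (s + n - 1) * ⋯ * W (s + 1) * W s`. -/
def backProd (W : ℕ → Matrix (Fin m) (Fin m) ℝ) (s : ℕ) : ℕ → Matrix (Fin m) (Fin m) ℝ
  | 0 => 1
  | n + 1 => W (s + n) * backProd W s n

/-- Nonnegative entries and unit row sums. -/
structure RowStochastic (M : Matrix (Fin m) (Fin m) ℝ) : Prop where
  nonneg : ∀ i j, 0 ≤ M i j
  row_sum : ∀ i, ∑ j, M i j = 1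

lemma mix_one (a : Fin m → V) : mix 1 a = a := by
  funext i
  simp [mix, Matrix.one_apply]

lemma mix_mul (M N : Matrix (Fin m) (Fin m) ℝ) (a : Fin m → V) :
    mix (M * N) a = mix M (mix N a) := by
  funext i
  simp only [mix, Matrix.mul_apply, Finset.sum_smul, Finset.smul_sum, smul_smul]
  exact Finset.sum_comm

lemma mix_add (M : Matrix (Fin m) (Fin m) ℝ) (a b : Fin m → V) :
    mix M (a + b) = mix M a + mix M b := by
  funext i
  simp [mix, Finset.sum_add_distrib]

lemma backProd_add (W : ℕ → Matrix (Fin m) (Fin m) ℝ) (s n k : ℕ) :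
    backProd W s (n + k) = backProd W (s + n) k * backProd W s n := by
  induction k with
  | zero => simp [backProd]
  | succ k ih =>
    rw [← add_assoc, backProd, ih, backProd, Matrix.mul_assoc, add_assoc]

lemma backProd_succ' (W : ℕ → Matrix (Fin m) (Fin m) ℝ) (s n : ℕ) :
    backProd W s (n + 1) = backProd W (s + 1) n * W s := by
  rw [add_comm n 1, backProd_add]
  simp [backProd]

lemma RowStochastic.one : RowStochastic (1 : Matrix (Fin m) (Fin m) ℝ) where
  nonneg i j := by
    rw [Matrix.one_apply]; split_ifs <;> norm_num
  row_sum i := by simp [Matrix.one_apply]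

lemma RowStochastic.mul {M N : Matrix (Fin m) (Fin m) ℝ} (hM : RowStochastic M)
    (hN : RowStochastic N) : RowStochastic (M * N) where
  nonneg i j := by
    rw [Matrix.mul_apply]
    exact Finset.sum_nonneg fun k _ => mul_nonneg (hM.nonneg i k) (hN.nonneg k j)
  row_sum i := by
    simp only [Matrix.mul_apply]
    rw [Finset.sum_comm]
    simp [← Finset.mul_sum, hN.row_sum, hM.row_sum]

lemma RowStochastic.backProd {W : ℕ → Matrix (Fin m) (Fin m) ℝ}
    (hW : ∀ t, RowStochastic (W t)) (s n : ℕ) : RowStochastic (backProd W s n) := by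
  induction n with
  | zero => exact RowStochastic.one
  | succ n ih => exact (hW _).mul ih

/-- Two averages of `a` whose nonnegative weights have the same total mass `s` are at distance at
most `s` times the diameter of `a`. -/
lemma norm_weighted_sub_le {a : Fin m → V} {r : ℝ} (ha : SpreadLE a r) {p q : Fin m → ℝ} {s : ℝ}
    (hs : 0 < s) (hp : ∀ j, 0 ≤ p j) (hq : ∀ j, 0 ≤ q j) (hps : ∑ j, p j = s)
    (hqs : ∑ j, q j = s) : ‖∑ j, p j • a j - ∑ j, q j • a j‖ ≤ s * r := by
  -- `s (∑ pⱼ aⱼ - ∑ qₗ aₗ) = ∑ⱼₗ pⱼ qₗ (aⱼ - aₗ)`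
  have key : s • (∑ j, p j • a j - ∑ j, q j • a j)
      = ∑ j, ∑ l, (p j * q l) • (a j - a l) := by
    simp only [smul_sub, Finset.sum_sub_distrib]
    congr 1
    · rw [Finset.smul_sum]
      refine Finset.sum_congr rfl fun j _ => ?_
      rw [← Finset.sum_smul, ← Finset.mul_sum, hqs, smul_smul, mul_comm]
    · rw [Finset.sum_comm, Finset.smul_sum]
      refine Finset.sum_congr rfl fun j _ => ?_
      rw [← Finset.sum_smul, ← Finset.sum_mul, hps, smul_smul]
  have h1 : ‖s • (∑ j, p j • a j - ∑ j, q j • a j)‖ ≤ ∑ j, ∑ l, (p j * q l) * r := by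
    rw [key]
    refine (norm_sum_le _ _).trans (Finset.sum_le_sum fun j _ => (norm_sum_le _ _).trans
      (Finset.sum_le_sum fun l _ => ?_))
    rw [norm_smul, Real.norm_of_nonneg (mul_nonneg (hp j) (hq l))]
    exact mul_le_mul_of_nonneg_left (ha j l) (mul_nonneg (hp j) (hq l))
  have h2 : ∑ j, ∑ l, (p j * q l) * r = s * (s * r) := by
    simp only [mul_assoc, ← Finset.mul_sum, ← Finset.sum_mul]
    rw [hps, hqs]
  rw [h2, norm_smul, Real.norm_of_nonneg hs.le] at h1
  exact le_of_mul_le_mul_left h1 hs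

/-- A row stochastic matrix with all entries at least `e` shrinks diameters by the factor
`1 - e`: the part `e` of the mass of any one column is common to all rows. -/
lemma SpreadLE.mix_of_le {a : Fin m → V} {r : ℝ} (ha : SpreadLE a r)
    {M : Matrix (Fin m) (Fin m) ℝ} (hM : RowStochastic M) {e : ℝ} (he : e < 1)
    (hMe : ∀ i j, e ≤ M i j) : SpreadLE (mix M a) ((1 - e) * r) := by
  intro i k
  have hN : ∀ l, ∑ j, (M l j - if j = i then e else 0) = 1 - e := fun l => by
    rw [Finset.sum_sub_distrib, hM.row_sum]; simp
  have hN0 : ∀ l j, 0 ≤ M l j - if j = i then e else 0 := fun l j => by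
    split_ifs
    · exact sub_nonneg.2 (hMe _ _)
    · simpa using hM.nonneg l j
  have h := norm_weighted_sub_le ha (sub_pos.2 he) (hN0 i) (hN0 k) (hN i) (hN k)
  simpa [mix, sub_smul, Finset.sum_sub_distrib] using h

lemma SpreadLE.mix {a : Fin m → V} {r : ℝ} (ha : SpreadLE a r)
    {M : Matrix (Fin m) (Fin m) ℝ} (hM : RowStochastic M) : SpreadLE (mix M a) r := by
  simpa using ha.mix_of_le hM zero_lt_one hM.nonneg

lemma norm_mix_sub_le {a : Fin m → V} {r : ℝ} (ha : SpreadLE a r)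
    {M : Matrix (Fin m) (Fin m) ℝ} (hM : RowStochastic M) (i : Fin m) :
    ‖mix M a i - a i‖ ≤ r := by
  have h := norm_weighted_sub_le ha one_pos (hM.nonneg i)
    (q := fun j => if j = i then 1 else 0) (fun j => by positivity) (hM.row_sum i) (by simp)
  simpa [SONATA.mix] using h

lemma norm_mix_sq_le {M : Matrix (Fin m) (Fin m) ℝ} (hM : RowStochastic M) (b : Fin m → V)
    (i : Fin m) : ‖mix M b i‖ ^ 2 ≤ ∑ j, ‖b j‖ ^ 2 := by
  have h1 : ‖SONATA.mix M b i‖ ≤ √(∑ j, ‖b j‖ ^ 2) := by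
    refine (norm_sum_le _ _).trans ?_
    rw [← one_mul (√_), ← hM.row_sum i, Finset.sum_mul]
    refine Finset.sum_le_sum fun j _ => ?_
    rw [norm_smul, Real.norm_of_nonneg (hM.nonneg i j)]
    refine mul_le_mul_of_nonneg_left (Real.le_sqrt_of_sq_le ?_) (hM.nonneg i j)
    exact Finset.single_le_sum (f := fun j => ‖b j‖ ^ 2) (fun _ _ => by positivity)
      (Finset.mem_univ j)
  calc _ ≤ √(∑ j, ‖b j‖ ^ 2) ^ 2 := by gcongr
    _ = _ := Real.sq_sqrt (Finset.sum_nonneg fun _ _ => by positivity)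

/-- The matrices `W t` have nonnegative entries, and entries at least `c` on the diagonal and
along the links of the digraphs `E t`. -/
structure Compatible (E : ℕ → Fin m → Fin m → Prop) (W : ℕ → Matrix (Fin m) (Fin m) ℝ) (c : ℝ) :
    Prop where
  pos : 0 < c
  nonneg : ∀ t i j, 0 ≤ W t i j
  diag : ∀ t i, c ≤ W t i i
  edge : ∀ t i j, i ≠ j → E t j i → c ≤ W t i j

namespace Compatible

variable {E : ℕ → Fin m → Fin m → Prop} {W : ℕ → Matrix (Fin m) (Fin m) ℝ} {c : ℝ}

lemma backProd_nonneg (hW : Compatible E W c) (s n : ℕ) (i j : Fin m) :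
    0 ≤ backProd W s n i j := by
  induction n generalizing i with
  | zero => rw [backProd, Matrix.one_apply]; split_ifs <;> norm_num
  | succ n ih =>
    rw [backProd, Matrix.mul_apply]
    exact Finset.sum_nonneg fun k _ => mul_nonneg (hW.nonneg _ i k) (ih k)

lemma le_backProd_succ (hW : Compatible E W c) {s n : ℕ} {i j k : Fin m}
    (hik : c ≤ W (s + n) i k) (hk : c ^ n ≤ backProd W s n k j) :
    c ^ (n + 1) ≤ backProd W s (n + 1) i j := by
  rw [backProd, Matrix.mul_apply, pow_succ']
  refine le_trans ?_ (Finset.single_le_sum (f := fun k => W (s + n) i k * backProd W s n k j)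
    (fun k _ => mul_nonneg (hW.nonneg _ i k) (hW.backProd_nonneg s n k j)) (Finset.mem_univ k))
  exact mul_le_mul hik hk (pow_nonneg hW.pos.le _) (hW.nonneg _ _ _)

lemma le_backProd_add (hW : Compatible E W c) {s n : ℕ} {i j : Fin m}
    (h : c ^ n ≤ backProd W s n i j) (k : ℕ) : c ^ (n + k) ≤ backProd W s (n + k) i j := by
  induction k with
  | zero => simpa using h
  | succ k ih => exact hW.le_backProd_succ (hW.diag _ i) ih

lemma pow_le_backProd_self (hW : Compatible E W c) (s n : ℕ) (i : Fin m) :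
    c ^ n ≤ backProd W s n i i := by
  simpa using hW.le_backProd_add (n := 0) (s := s) (i := i) (j := i) (by simp [backProd]) n

/-- After `n` windows at least `n + 1` agents have received information from `j`: as long as some
agent has not, strong connectivity provides a link towards such an agent during the next
window. -/
lemma card_reached (hW : Compatible E W c) {B : ℕ} (hE : StronglyConnected E B) (k : ℕ)
    (j : Fin m) (n : ℕ) : min m (n + 1) ≤
      (Finset.univ.filter fun i => c ^ (n * B) ≤ backProd W (k * B) (n * B) i j).card := by
  induction n with
  | zero =>
    refine (min_le_right _ _).trans (Finset.card_pos.2 ⟨j, ?_⟩)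
    simp [backProd]
  | succ n ih =>
    set R := Finset.univ.filter fun i => c ^ (n * B) ≤ backProd W (k * B) (n * B) i j with hR
    set R' := Finset.univ.filter
      fun i => c ^ ((n + 1) * B) ≤ backProd W (k * B) ((n + 1) * B) i j with hR'
    have hsub : R ⊆ R' := fun i hi => by
      rw [hR, Finset.mem_filter] at hi
      rw [hR', Finset.mem_filter, add_mul, one_mul]
      exact ⟨Finset.mem_univ _, hW.le_backProd_add hi.2 B⟩
    by_cases hall : R = Finset.univ
    · have : R' = Finset.univ := Finset.univ_subset_iff.1 (hall ▸ hsub)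
      rw [this, Finset.card_univ, Fintype.card_fin]
      exact min_le_left _ _
    obtain ⟨b, hb⟩ : ∃ b, b ∉ R := by
      by_contra! h
      exact hall (Finset.eq_univ_of_forall h)
    have hj : j ∈ R := by
      rw [hR, Finset.mem_filter]
      exact ⟨Finset.mem_univ _, hW.pow_le_backProd_self _ _ j⟩
    -- a link of the window `k + n` that leaves `R`
    obtain ⟨u, v, hu, hv, t, ht1, ht2, hE'⟩ : ∃ u v, u ∈ R ∧ v ∉ R ∧
        ∃ t, (k + n) * B ≤ t ∧ t < (k + n + 1) * B ∧ E t u v := by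
      by_contra! h
      have : ∀ w, Relation.ReflTransGen
          (fun u v => ∃ t, (k + n) * B ≤ t ∧ t < (k + n + 1) * B ∧ E t u v) j w → w ∈ R := by
        intro w hw
        induction hw with
        | refl => exact hj
        | tail _ hstep ih' =>
          by_contra hw
          obtain ⟨t, h1, h2, h3⟩ := hstep
          exact h _ _ ih' hw t h1 h2 h3
      exact hb (this b (hE.2 (k + n) j b))
    have hv' : v ∈ R' := by
      rw [hR, Finset.mem_filter] at hu
      obtain ⟨l, rfl⟩ := Nat.exists_eq_add_of_le ht1
      have huv : v ≠ u := by
        rintro rfl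
        exact hv (by rw [hR, Finset.mem_filter]; exact hu)
      have h1 := hW.le_backProd_add hu.2 l
      have h2 := hW.le_backProd_succ (i := v) (hW.edge (k * B + (n * B + l)) v u huv
        (by rwa [← add_assoc, ← add_mul])) h1
      have hl : l + 1 ≤ B := by
        rw [add_mul (k + n) 1, one_mul] at ht2; omega
      obtain ⟨r, hr⟩ := Nat.exists_eq_add_of_le hl
      have h3 := hW.le_backProd_add h2 r
      rw [hR', Finset.mem_filter]
      refine ⟨Finset.mem_univ _, ?_⟩
      have : (n + 1) * B = n * B + l + 1 + r := by rw [add_mul, one_mul]; omega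
      rwa [this]
    have hlt : R.card < R'.card := Finset.card_lt_card
      ⟨hsub, fun h => hv (h hv')⟩
    omega

/-- Over `m - 1` consecutive windows every agent reaches every other one. -/
lemma pow_le_backProd (hW : Compatible E W c) {B : ℕ} (hE : StronglyConnected E B)
    (k : ℕ) (i j : Fin m) :
    c ^ ((m - 1) * B) ≤ backProd W (k * B) ((m - 1) * B) i j := by
  have hm : 0 < m := i.pos
  have h := hW.card_reached hE k j (m - 1)
  rw [Nat.sub_add_cancel hm, min_self] at h
  have h2 := Finset.eq_univ_of_card _ (le_antisymm (Finset.card_le_univ _)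
    (by rwa [Fintype.card_fin]))
  have := h2 ▸ Finset.mem_univ i
  exact (Finset.mem_filter.1 this).2

/-- Geometric decay of diameters under products of `n` matrices with arbitrary starting time.  The
two factors `1 - c ^ N` on the left account for the steps before the first window that lies
entirely in the time interval, and for those after the last complete group of `m - 1` windows. -/
lemma spreadLE_backProd (hW : Compatible E W c) (hS : ∀ t, RowStochastic (W t)) {B : ℕ}
    (hE : StronglyConnected E B) (hm : 2 ≤ m) {ρ : ℝ} (hρ0 : 0 < ρ) (hρ1 : ρ ≤ 1)
    (hρ : ρ ^ ((m - 1) * B) = 1 - c ^ ((m - 1) * B)) (s n : ℕ) {a : Fin m → V} {r : ℝ}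
    (hr : 0 ≤ r) (ha : SpreadLE a r) :
    SpreadLE (SONATA.mix (backProd W s n) a) (((1 - c ^ ((m - 1) * B)) ^ 2)⁻¹ * ρ ^ n * r) := by
  set N := (m - 1) * B with hN
  have hNB : B ≤ N := Nat.le_mul_of_pos_left B (by omega)
  have hB : 0 < B := hE.1
  -- a whole number of groups of `m - 1` windows
  have h1 : ∀ (q k : ℕ) (a : Fin m → V) (r : ℝ), SpreadLE a r →
      SpreadLE (SONATA.mix (backProd W (k * B) (q * N)) a) (ρ ^ (q * N) * r) := by
    intro q
    induction q with
    | zero => intro k a r ha; simpa [backProd, mix_one] using ha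
    | succ q ih =>
      intro k a r ha
      have h := ih k a r ha
      have hpos : (k * B + q * N) = (k + q * (m - 1)) * B := by rw [hN]; ring
      have h2 := h.mix_of_le (RowStochastic.backProd hS ((k + q * (m - 1)) * B) N)
        (e := c ^ N) (by linarith [pow_pos hρ0 N]) (fun i j => hW.pow_le_backProd hE _ i j)
      rw [← mix_mul, ← hpos, ← backProd_add] at h2
      rw [add_mul, one_mul]
      refine h2.mono (le_of_eq ?_)
      rw [← hρ, pow_add]; ring
  -- any number of steps from the beginning of a window
  have h2 : ∀ (n k : ℕ) (a : Fin m → V) (r : ℝ), 0 ≤ r → SpreadLE a r →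
      SpreadLE (SONATA.mix (backProd W (k * B) n) a) ((ρ ^ N)⁻¹ * ρ ^ n * r) := by
    intro n k a r hr ha
    have h := (h1 (n / N) k a r ha).mix
      (RowStochastic.backProd hS (k * B + n / N * N) (n % N))
    rw [← mix_mul, ← backProd_add, Nat.div_add_mod'] at h
    refine h.mono (mul_le_mul_of_nonneg_right ?_ hr)
    rw [le_inv_mul_iff₀ (pow_pos hρ0 N), ← pow_add]
    refine pow_le_pow_of_le_one hρ0.le hρ1 ?_
    have := Nat.div_add_mod' n N
    have := Nat.mod_lt n (by omega : 0 < N)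
    omega
  have hNpos : 0 < ρ ^ N := pow_pos hρ0 N
  rw [← hρ]
  obtain ⟨l, k, hlB, hl⟩ : ∃ l k, l < B ∧ s + l = k * B := by
    rcases Nat.eq_zero_or_pos (s % B) with h0 | h0
    · exact ⟨0, s / B, hB, by have := Nat.div_add_mod' s B; omega⟩
    · refine ⟨B - s % B, s / B + 1, by omega, ?_⟩
      have := Nat.div_add_mod' s B
      have := Nat.mod_lt s hB
      rw [add_mul, one_mul]; omega
  rcases le_or_gt l n with hln | hln
  · obtain ⟨n', rfl⟩ := Nat.exists_eq_add_of_le hln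
    have h := h2 n' k _ r hr (ha.mix (RowStochastic.backProd hS s l))
    rw [← mix_mul, ← hl, ← backProd_add] at h
    refine h.mono (mul_le_mul_of_nonneg_right ?_ hr)
    rw [pow_two, mul_inv, mul_assoc]
    refine mul_le_mul_of_nonneg_left ?_ (by positivity)
    rw [le_inv_mul_iff₀ hNpos, ← pow_add]
    exact pow_le_pow_of_le_one hρ0.le hρ1 (by omega)
  · refine (ha.mix (RowStochastic.backProd hS s n)).mono ?_
    have h3 : 1 ≤ ((ρ ^ N) ^ 2)⁻¹ * ρ ^ n := by
      rw [le_inv_mul_iff₀ (by positivity), mul_one, ← pow_mul]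
      exact pow_le_pow_of_le_one hρ0.le hρ1 (by omega)
    nlinarith

end Compatible

/-- Consensus with perturbations.  The scalar sequence `X` dominates the squared disagreement of
`a` and contracts at every step, although the disagreement itself contracts only over several
windows: `√(X ν / m)` bounds `ρ ^ (-n)` times the diameter of `a ν` after `n` further averaging
steps, for all `n` at once. -/
lemma exists_consensus_bound {W : ℕ → Matrix (Fin m) (Fin m) ℝ} {ρ κ : ℝ}
    (hρ0 : 0 < ρ) (hρ1 : ρ < 1) (hκ : 0 ≤ κ)
    (hW : ∀ (s n : ℕ) (a : Fin m → V) (r : ℝ), 0 ≤ r → SpreadLE a r →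
      SpreadLE (SONATA.mix (backProd W s n) a) (κ * ρ ^ n * r))
    {a b : ℕ → Fin m → V} (hab : ∀ ν, a (ν + 1) = SONATA.mix (W ν) (a ν + b ν)) :
    ∃ X : ℕ → ℝ, (∀ ν, 0 ≤ X ν) ∧ (∀ ν i j, m * ‖a ν i - a ν j‖ ^ 2 ≤ X ν) ∧
      ∀ ν, X (ν + 1) ≤ ρ * X ν + 2 * m * κ ^ 2 * ρ ^ 2 / (1 - ρ) * ∑ i, ‖b ν i‖ ^ 2 := by
  set β : ℕ → ℝ := fun ν => √(2 * ∑ i, ‖b ν i‖ ^ 2) with hβ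
  have hβ0 : ∀ ν, 0 ≤ β ν := fun ν => Real.sqrt_nonneg _
  let Y : ℕ → ℝ := fun ν => Nat.rec (κ * √(2 * ∑ i, ‖a 0 i‖ ^ 2))
    (fun ν y => ρ * y + ρ * κ * β ν) ν
  have hY1 : ∀ ν, Y (ν + 1) = ρ * Y ν + ρ * κ * β ν := fun ν => rfl
  have hY0 : ∀ ν, 0 ≤ Y ν := by
    intro ν
    induction ν with
    | zero => exact mul_nonneg hκ (Real.sqrt_nonneg _)
    | succ ν ih => rw [hY1]; have := hβ0 ν; positivity
  have hmain : ∀ ν n, SpreadLE (SONATA.mix (backProd W ν n) (a ν)) (ρ ^ n * Y ν) := by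
    intro ν
    induction ν with
    | zero =>
      intro n
      refine (hW 0 n _ _ (Real.sqrt_nonneg _) (spreadLE_sqrt (a 0))).mono (le_of_eq ?_)
      change _ = ρ ^ n * (κ * √(2 * ∑ i, ‖a 0 i‖ ^ 2))
      ring
    | succ ν ih =>
      intro n
      rw [hab, ← mix_mul, ← backProd_succ', mix_add]
      refine ((ih (n + 1)).add (hW ν (n + 1) _ _ (hβ0 ν) (spreadLE_sqrt (b ν)))).mono
        (le_of_eq ?_)
      rw [hY1]; ring
  refine ⟨fun ν => m * Y ν ^ 2, fun ν => by positivity, fun ν i j => ?_, fun ν => ?_⟩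
  · have h := hmain ν 0 i j
    rw [backProd, mix_one, pow_zero, one_mul] at h
    change (m : ℝ) * ‖a ν i - a ν j‖ ^ 2 ≤ m * Y ν ^ 2
    gcongr
  · have hb : β ν ^ 2 = 2 * ∑ i, ‖b ν i‖ ^ 2 :=
      Real.sq_sqrt (mul_nonneg zero_le_two (Finset.sum_nonneg fun _ _ => by positivity))
    have h1 : 0 < 1 - ρ := sub_pos.2 hρ1
    -- `(ρ Y + t)² ≤ ρ Y² + t² / (1 - ρ)` by convexity of the square
    have h2 : (ρ * Y ν + ρ * κ * β ν) ^ 2 ≤ ρ * Y ν ^ 2 + (ρ * κ * β ν) ^ 2 / (1 - ρ) := by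
      rw [← sub_nonneg]
      have : ρ * Y ν ^ 2 + (ρ * κ * β ν) ^ 2 / (1 - ρ) - (ρ * Y ν + ρ * κ * β ν) ^ 2
          = ρ / (1 - ρ) * ((1 - ρ) * Y ν - ρ * κ * β ν) ^ 2 := by
        field_simp; ring
      rw [this]; positivity
    calc (m : ℝ) * Y (ν + 1) ^ 2 ≤ m * (ρ * Y ν ^ 2 + (ρ * κ * β ν) ^ 2 / (1 - ρ)) := by
          rw [hY1]; gcongr
      _ = ρ * (m * Y ν ^ 2) + m * κ ^ 2 * ρ ^ 2 / (1 - ρ) * β ν ^ 2 := by field_simp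
      _ = _ := by rw [hb]; ring

end Mixing

/-! ### First-order consequences of second-order bounds -/

section Calculus

variable {d : ℕ}

/-- On `K` the function `g`, with gradient map `Φ`, lies above its tangent planes by at least
`a / 2` times the squared distance.  Here `a` may be negative. -/
def FirstOrderLB (K : Set (Vec d)) (g : Vec d → ℝ) (Φ : Vec d → Vec d) (a : ℝ) : Prop :=
  ∀ x ∈ K, ∀ y ∈ K, g x + ⟪Φ x, y - x⟫_ℝ + a / 2 * ‖y - x‖ ^ 2 ≤ g y

lemma hasDerivAt_comp_line {g : Vec d → ℝ} {x v p : Vec d} {t : ℝ}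
    (h : HasGradientAt g p (x + t • v)) : HasDerivAt (fun s : ℝ => g (x + s • v)) ⟪p, v⟫_ℝ t := by
  have h1 : HasDerivAt (fun s : ℝ => x + s • v) v t := by
    simpa using ((hasDerivAt_id t).smul_const v).const_add x
  exact (hasGradientAt_iff_hasFDerivAt.1 h).comp_hasDerivAt t h1

lemma hasDerivAt_inner_comp_line {Φ : Vec d → Vec d} {A : Vec d →L[ℝ] Vec d} {x v w : Vec d}
    {t : ℝ} (h : HasFDerivAt Φ A (x + t • v)) :
    HasDerivAt (fun s : ℝ => ⟪w, Φ (x + s • v)⟫_ℝ) ⟪w, A v⟫_ℝ t := by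
  have h1 : HasDerivAt (fun s : ℝ => x + s • v) v t := by
    simpa using ((hasDerivAt_id t).smul_const v).const_add x
  simpa using (hasDerivAt_const t w).inner ℝ (h.comp_hasDerivAt t h1)

lemma line_mem {K : Set (Vec d)} (hK : Convex ℝ K) {x y : Vec d} (hx : x ∈ K) (hy : y ∈ K) {t : ℝ}
    (h0 : 0 ≤ t) (h1 : t ≤ 1) : x + t • (y - x) ∈ K :=
  hK.add_smul_sub_mem hx hy ⟨h0, h1⟩

/-- A function on `[0, 1]` that is smallest at `0` has nonnegative derivative there. -/
lemma deriv_nonneg_of_le {φ : ℝ → ℝ} {φ' : ℝ} (h : HasDerivAt φ φ' 0)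
    (hle : ∀ t, 0 < t → t ≤ 1 → φ 0 ≤ φ t) : 0 ≤ φ' := by
  refine ge_of_tendsto h.tendsto_slope_zero_right ?_
  filter_upwards [Ioc_mem_nhdsGT (zero_lt_one' ℝ)] with t ht
  rw [zero_add, smul_eq_mul]
  exact mul_nonneg (inv_nonneg.2 ht.1.le) (sub_nonneg.2 (hle t ht.1 ht.2))

lemma inner_sub_ge_of_lowerBd {K : Set (Vec d)} (hK : Convex ℝ K) {Φ : Vec d → Vec d}
    {A : Vec d → Vec d →L[ℝ] Vec d} {a : ℝ} (hΦ : ∀ x ∈ K, HasFDerivAt Φ (A x) x)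
    (hA : ∀ x ∈ K, LowerBd a (A x)) {x y : Vec d} (hx : x ∈ K) (hy : y ∈ K) :
    a * ‖y - x‖ ^ 2 ≤ ⟪Φ y - Φ x, y - x⟫_ℝ := by
  have hd : ∀ t ∈ Set.Icc (0 : ℝ) 1, HasDerivAt (fun s : ℝ => ⟪y - x, Φ (x + s • (y - x))⟫_ℝ)
      ⟪y - x, A (x + t • (y - x)) (y - x)⟫_ℝ t := fun t ht =>
    hasDerivAt_inner_comp_line (hΦ _ (line_mem hK hx hy ht.1 ht.2))
  obtain ⟨c, hc, h⟩ := exists_hasDerivAt_eq_slope _ _ zero_lt_one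
    (fun t ht => (hd t ht).continuousAt.continuousWithinAt)
    (fun t ht => hd t (Set.Ioo_subset_Icc_self ht))
  have h2 := hA _ (line_mem hK hx hy hc.1.le hc.2.le) (y - x)
  rw [h] at h2
  simpa [← inner_sub_right, real_inner_comm (y - x)] using h2

lemma FirstOrderLB.of_lowerBd {K : Set (Vec d)} (hK : Convex ℝ K) {g : Vec d → ℝ}
    {Φ : Vec d → Vec d} {A : Vec d → Vec d →L[ℝ] Vec d} {a : ℝ}
    (hg : ∀ x ∈ K, HasGradientAt g (Φ x) x) (hΦ : ∀ x ∈ K, HasFDerivAt Φ (A x) x)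
    (hA : ∀ x ∈ K, LowerBd a (A x)) : FirstOrderLB K g Φ a := by
  intro x hx y hy
  set v := y - x with hv
  have hd : ∀ t ∈ Set.Icc (0 : ℝ) 1, HasDerivAt
      (fun s : ℝ => g (x + s • v) - s * ⟪Φ x, v⟫_ℝ - a / 2 * ‖v‖ ^ 2 * s ^ 2)
      (⟪Φ (x + t • v), v⟫_ℝ - ⟪Φ x, v⟫_ℝ - a * ‖v‖ ^ 2 * t) t := fun t ht => by
    have h1 := hasDerivAt_comp_line (hg _ (line_mem hK hx hy ht.1 ht.2))
    have h2 := (h1.sub ((hasDerivAt_id t).mul_const ⟪Φ x, v⟫_ℝ)).sub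
      ((hasDerivAt_pow 2 t).const_mul (a / 2 * ‖v‖ ^ 2))
    refine h2.congr_deriv ?_
    rw [← hv]; push_cast; ring
  obtain ⟨c, hc, h⟩ := exists_hasDerivAt_eq_slope _ _ zero_lt_one
    (fun t ht => (hd t ht).continuousAt.continuousWithinAt)
    (fun t ht => hd t (Set.Ioo_subset_Icc_self ht))
  have h2 := inner_sub_ge_of_lowerBd hK hΦ hA hx (line_mem hK hx hy hc.1.le hc.2.le)
  rw [← hv, add_sub_cancel_left, norm_smul, inner_smul_right, inner_sub_left,
    Real.norm_of_nonneg hc.1.le] at h2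
  have h3 : 0 ≤ ⟪Φ (x + c • v), v⟫_ℝ - ⟪Φ x, v⟫_ℝ - a * ‖v‖ ^ 2 * c := by
    have : 0 ≤ c * (⟪Φ (x + c • v), v⟫_ℝ - ⟪Φ x, v⟫_ℝ - a * ‖v‖ ^ 2 * c) := by nlinarith
    exact nonneg_of_mul_nonneg_right this hc.1
  rw [h] at h3
  simp [hv] at h3
  rw [← hv] at h3
  linarith

lemma FirstOrderLB.of_strongConvexOn {K : Set (Vec d)} {g : Vec d → ℝ} {Φ : Vec d → Vec d} {a : ℝ}
    (h : StrongConvexOn K a g) (hg : ∀ x ∈ K, HasGradientAt g (Φ x) x) :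
    FirstOrderLB K g Φ a := by
  intro x hx y hy
  have h1 : HasDerivAt (fun s : ℝ => g (x + s • (y - x))) ⟪Φ x, y - x⟫_ℝ 0 :=
    hasDerivAt_comp_line (by simpa using hg x hx)
  have h2 : HasDerivAt (fun s : ℝ => s * (g y - g x) - s * (1 - s) * (a / 2 * ‖y - x‖ ^ 2)
      - g (x + s • (y - x))) (g y - g x - a / 2 * ‖y - x‖ ^ 2 - ⟪Φ x, y - x⟫_ℝ) 0 := by
    have h3 := (((hasDerivAt_id (0 : ℝ)).mul_const (g y - g x)).sub
      (((hasDerivAt_id (0 : ℝ)).mul ((hasDerivAt_id (0 : ℝ)).const_sub 1)).mul_const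
        (a / 2 * ‖y - x‖ ^ 2))).sub h1
    refine h3.congr_deriv ?_
    rw [id]; ring
  have h4 := deriv_nonneg_of_le h2 fun t ht0 ht1 => by
    have := h.2 hx hy (sub_nonneg.2 ht1) ht0.le (sub_add_cancel 1 t)
    have he : (1 - t) • x + t • y = x + t • (y - x) := by module
    rw [he, norm_sub_rev x y] at this
    simp only [smul_eq_mul] at this
    simp only [zero_mul, zero_smul, add_zero, sub_zero]
    linarith
  linarith

lemma FirstOrderLB.inner_sub_ge {K : Set (Vec d)} {g : Vec d → ℝ} {Φ : Vec d → Vec d} {a : ℝ}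
    (h : FirstOrderLB K g Φ a) {x y : Vec d} (hx : x ∈ K) (hy : y ∈ K) :
    a * ‖y - x‖ ^ 2 ≤ ⟪Φ y - Φ x, y - x⟫_ℝ := by
  have h1 := h x hx y hy
  have h2 := h y hy x hx
  rw [← neg_sub y x, norm_neg, inner_neg_right] at h2
  rw [inner_sub_left]
  linarith

lemma FirstOrderLB.mono {K : Set (Vec d)} {g : Vec d → ℝ} {Φ : Vec d → Vec d} {a b : ℝ}
    (h : FirstOrderLB K g Φ a) (hb : b ≤ a) : FirstOrderLB K g Φ b := fun x hx y hy => by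
  have := h x hx y hy
  nlinarith [sq_nonneg ‖y - x‖]

lemma FirstOrderLB.strongConvexOn {K : Set (Vec d)} (hK : Convex ℝ K) {g : Vec d → ℝ}
    {Φ : Vec d → Vec d} {a : ℝ} (h : FirstOrderLB K g Φ a) : StrongConvexOn K a g := by
  refine ⟨hK, fun x hx y hy s t hs ht hst => ?_⟩
  have hw := hK hx hy hs ht hst
  have h1 := h _ hw x hx
  have h2 := h _ hw y hy
  obtain rfl : s = 1 - t := by linarith
  have e1 : x - ((1 - t) • x + t • y) = t • (x - y) := by module
  have e2 : y - ((1 - t) • x + t • y) = -((1 - t) • (x - y)) := by module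
  rw [e1, norm_smul, inner_smul_right, Real.norm_of_nonneg ht] at h1
  rw [e2, norm_neg, norm_smul, inner_neg_right, inner_smul_right, Real.norm_of_nonneg hs] at h2
  simp only [smul_eq_mul]
  have h3 := mul_le_mul_of_nonneg_left h1 hs
  have h4 := mul_le_mul_of_nonneg_left h2 ht
  linear_combination h3 + h4

/-- The Hessian is symmetric. -/
lemma hess_symm {g : Vec d → ℝ} {O : Set (Vec d)} (hO : IsOpen O) (hg : DifferentiableOn ℝ g O)
    (hg2 : DifferentiableOn ℝ (gradient g) O) {x : Vec d} (hx : x ∈ O) (u v : Vec d) :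
    ⟪hess g x u, v⟫_ℝ = ⟪u, hess g x v⟫_ℝ := by
  have h1 : ∀ᶠ y in 𝓝 x, HasFDerivAt g (innerSL ℝ (gradient g y)) y := by
    filter_upwards [hO.mem_nhds hx] with y hy
    exact hasGradientAt_iff_hasFDerivAt.1 ((hg y hy).differentiableAt (hO.mem_nhds hy)).hasGradientAt
  have h2 : HasFDerivAt (fun y => innerSL ℝ (gradient g y)) ((innerSL ℝ).comp (hess g x)) x :=
    (innerSL ℝ).hasFDerivAt.comp x
      ((hg2 x hx).differentiableAt (hO.mem_nhds hx)).hasFDerivAt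
  have h3 := second_derivative_symmetric_of_eventually h1 h2 u v
  simp only [ContinuousLinearMap.comp_apply, innerSL_apply_apply] at h3
  rw [h3, real_inner_comm]

/-- The norm of a symmetric operator is bounded by its quadratic form. -/
lemma opNorm_le_of_symm {A : Vec d →L[ℝ] Vec d} (hA : ∀ u v, ⟪A u, v⟫_ℝ = ⟪u, A v⟫_ℝ) {D : ℝ}
    (hD : 0 ≤ D) (hl : LowerBd (-D) A) (hu : UpperBd A D) : ‖A‖ ≤ D := by
  refine A.opNorm_le_bound hD fun u => ?_
  rcases eq_or_ne u 0 with rfl | hu0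
  · simp
  rcases eq_or_ne (A u) 0 with hAu | hAu
  · rw [hAu, norm_zero]; positivity
  -- polarization at `u` and the multiple of `A u` that has the norm of `u`
  set s := ‖u‖ / ‖A u‖ with hs
  have hv : ‖s • A u‖ = ‖u‖ := by
    rw [norm_smul, Real.norm_of_nonneg (by positivity)]
    exact div_mul_cancel₀ _ (norm_ne_zero_iff.2 hAu)
  have h1 := hu (u + s • A u)
  have h2 := hl (u - s • A u)
  have h3 := parallelogram_law_with_norm ℝ u (s • A u)
  have h4 : ⟪u + s • A u, A (u + s • A u)⟫_ℝ - ⟪u - s • A u, A (u - s • A u)⟫_ℝ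
      = 4 * (s * ‖A u‖ ^ 2) := by
    have h5 : ⟪u, A (A u)⟫_ℝ = ‖A u‖ ^ 2 := by rw [← hA, real_inner_self_eq_norm_sq]
    simp only [map_add, map_sub, map_smul, inner_add_left, inner_add_right, inner_sub_left,
      inner_sub_right, real_inner_smul_left, real_inner_smul_right, h5, real_inner_self_eq_norm_sq]
    ring
  have h5 : s * ‖A u‖ ^ 2 = ‖u‖ * ‖A u‖ := by
    rw [hs]; field_simp [norm_ne_zero_iff.2 hAu]
  rw [h5] at h4
  rw [hv] at h3
  have h6 : ‖u‖ * ‖A u‖ ≤ ‖u‖ * (D * ‖u‖) := by nlinarith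
  exact le_of_mul_le_mul_left h6 (norm_pos_iff.2 hu0)

lemma norm_sub_le_of_symm {K : Set (Vec d)} (hK : Convex ℝ K) {Φ : Vec d → Vec d}
    {A : Vec d → Vec d →L[ℝ] Vec d} {D : ℝ} (hD : 0 ≤ D)
    (hΦ : ∀ x ∈ K, HasFDerivAt Φ (A x) x) (hA : ∀ x ∈ K, ∀ u v, ⟪A x u, v⟫_ℝ = ⟪u, A x v⟫_ℝ)
    (hl : ∀ x ∈ K, LowerBd (-D) (A x)) (hu : ∀ x ∈ K, UpperBd (A x) D) {x y : Vec d}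
    (hx : x ∈ K) (hy : y ∈ K) : ‖Φ y - Φ x‖ ≤ D * ‖y - x‖ :=
  hK.norm_image_sub_le_of_norm_hasFDerivWithin_le (fun z hz => (hΦ z hz).hasFDerivWithinAt)
    (fun z hz => opNorm_le_of_symm (hA z hz) hD (hl z hz) (hu z hz)) hx hy

lemma hess_nonneg_of_convexOn {g : Vec d → ℝ} {O : Set (Vec d)} (hO : IsOpen O)
    (hg : DifferentiableOn ℝ g O) (hg2 : DifferentiableOn ℝ (gradient g) O)
    (hc : ConvexOn ℝ O g) {x : Vec d} (hx : x ∈ O) : LowerBd 0 (hess g x) := by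
  intro v
  have hgr : ∀ y ∈ O, HasGradientAt g (gradient g y) y := fun y hy =>
    ((hg y hy).differentiableAt (hO.mem_nhds hy)).hasGradientAt
  have hfo : FirstOrderLB O g (gradient g) 0 :=
    FirstOrderLB.of_strongConvexOn (strongConvexOn_zero.2 hc) hgr
  have hd : HasDerivAt (fun s : ℝ => ⟪v, gradient g (x + s • v)⟫_ℝ) ⟪v, hess g x v⟫_ℝ 0 :=
    hasDerivAt_inner_comp_line
      (by simpa [hess] using ((hg2 x hx).differentiableAt (hO.mem_nhds hx)).hasFDerivAt)
  have hmem : ∀ᶠ t : ℝ in 𝓝[>] 0, x + t • v ∈ O := by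
    have hc : ContinuousAt (fun t : ℝ => x + t • v) 0 := by fun_prop
    exact (hc.eventually_mem (by simpa using hO.mem_nhds hx)).filter_mono nhdsWithin_le_nhds
  rw [zero_mul]
  refine ge_of_tendsto hd.tendsto_slope_zero_right ?_
  filter_upwards [hmem, self_mem_nhdsWithin] with t ht ht0
  have ht0' : 0 < t := ht0
  have h := hfo.inner_sub_ge hx ht
  rw [add_sub_cancel_left, inner_smul_right, zero_mul, real_inner_comm] at h
  rw [zero_add, smul_eq_mul, zero_smul, add_zero, ← inner_sub_right]
  exact mul_nonneg (inv_nonneg.2 ht0'.le) (nonneg_of_mul_nonneg_right h ht0')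

/-- The variational inequality satisfied by a minimizer of a smooth plus a convex function. -/
lemma variational_of_isMinOn {K : Set (Vec d)} {h G : Vec d → ℝ} (hG : ConvexOn ℝ K G)
    {p z : Vec d} (hz : z ∈ K) (hh : HasGradientAt h p z)
    (hmin : ∀ w ∈ K, h z + G z ≤ h w + G w) {w : Vec d} (hw : w ∈ K) :
    0 ≤ ⟪p, w - z⟫_ℝ + (G w - G z) := by
  have h1 : HasDerivAt (fun s : ℝ => h (z + s • (w - z)) + s * (G w - G z))
      (⟪p, w - z⟫_ℝ + 1 * (G w - G z)) 0 :=
    (hasDerivAt_comp_line (by simpa using hh)).add ((hasDerivAt_id (0 : ℝ)).mul_const _)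
  have h2 := deriv_nonneg_of_le h1 fun t ht0 ht1 => by
    have h3 := hmin _ (line_mem hG.1 hz hw ht0.le ht1)
    have h4 := hG.2 hz hw (sub_nonneg.2 ht1) ht0.le (sub_add_cancel 1 t)
    have he : (1 - t) • z + t • w = z + t • (w - z) := by module
    rw [he] at h4
    simp only [smul_eq_mul] at h4
    simp only [zero_smul, add_zero, zero_mul]
    linarith
  simpa using h2

end Calculus

/-! ### Limits of minimizing sequences -/

section Minimizer

variable {d : ℕ} {K : Set (Vec d)} {F G : Vec d → ℝ} {Φ : Vec d → Vec d} {μ : ℝ}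

/-- `G` need not be lower semicontinuous, so `F + G` need not attain its infimum on `K`.  The limit
`xs` of a minimizing sequence serves as well, with the limit `Gs` of the values of `G` along that
sequence in place of `G xs`: the pair satisfies the optimality condition, and affine minorants of
`G` on `K` pass to the limit. -/
lemma exists_limit_minimizer (hne : K.Nonempty) (hcl : IsClosed K) (hμ : 0 < μ)
    (hF : FirstOrderLB K F Φ μ) (hΦ : ∀ x ∈ K, HasGradientAt F (Φ x) x) (hG : ConvexOn ℝ K G)
    (hbdd : BddBelow ((fun x => F x + G x) '' K)) :
    ∃ xs ∈ K, ∃ Gs : ℝ, F xs + Gs = sInf ((fun x => F x + G x) '' K) ∧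
      (∀ w ∈ K, 0 ≤ ⟪Φ xs, w - xs⟫_ℝ + (G w - Gs)) ∧
      ∀ (p z : Vec d) (b : ℝ), (∀ w ∈ K, 0 ≤ ⟪p, w - z⟫_ℝ + (G w - b)) →
        0 ≤ ⟪p, xs - z⟫_ℝ + (Gs - b) := by
  set Us := sInf ((fun x => F x + G x) '' K) with hUs
  have hlb : ∀ w ∈ K, Us ≤ F w + G w := fun w hw => csInf_le hbdd ⟨w, hw, rfl⟩
  obtain ⟨u, -, hu, hmem⟩ := exists_seq_tendsto_sInf (hne.image _) hbdd
  choose x hxK hxu using hmem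
  have hU : Tendsto (fun n => F (x n) + G (x n)) atTop (𝓝 Us) := by
    refine hu.congr fun n => (hxu n).symm
  have hstr := hF.strongConvexOn hG.1
  -- strong convexity turns near-minimality into closeness
  have hsq : ∀ n k, μ / 8 * ‖x n - x k‖ ^ 2
      ≤ ((F (x n) + G (x n) - Us) + (F (x k) + G (x k) - Us)) / 2 := by
    intro n k
    have h0 : (0 : ℝ) ≤ 1 / 2 := by norm_num
    have h1 := hstr.2 (hxK n) (hxK k) h0 h0 (by norm_num)
    have h2 := hG.2 (hxK n) (hxK k) h0 h0 (by norm_num)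
    have h3 := hlb _ (hG.1 (hxK n) (hxK k) h0 h0 (by norm_num))
    simp only [smul_eq_mul] at h1 h2
    linarith
  have hcauchy : CauchySeq x := by
    rw [Metric.cauchySeq_iff]
    intro ε hε
    have hev : ∀ᶠ n in atTop, F (x n) + G (x n) < Us + μ / 8 * ε ^ 2 :=
      hU.eventually_lt_const (by have : 0 < μ / 8 * ε ^ 2 := by positivity
                                 linarith)
    obtain ⟨N, hN⟩ := eventually_atTop.1 hev
    refine ⟨N, fun n hn k hk => ?_⟩
    have h1 := hN n hn
    have h2 := hN k hk
    have h3 := hsq n k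
    have h4 : μ / 8 * ‖x n - x k‖ ^ 2 < μ / 8 * ε ^ 2 := by linarith
    have h5 := lt_of_mul_lt_mul_left h4 (by positivity)
    rw [dist_eq_norm]
    exact lt_of_pow_lt_pow_left₀ 2 hε.le h5
  obtain ⟨xs, hxs⟩ := cauchySeq_tendsto_of_complete hcauchy
  have hxsK : xs ∈ K := hcl.mem_of_tendsto hxs (Eventually.of_forall hxK)
  have hFlim : Tendsto (fun n => F (x n)) atTop (𝓝 (F xs)) :=
    (hΦ xs hxsK).continuousAt.tendsto.comp hxs
  have hGlim : Tendsto (fun n => G (x n)) atTop (𝓝 (Us - F xs)) := by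
    simpa using hU.sub hFlim
  refine ⟨xs, hxsK, Us - F xs, by ring, fun w hw => ?_, fun p z b h => ?_⟩
  · have h1 : HasDerivAt (fun s : ℝ => F (xs + s • (w - xs)) + s * (G w - (Us - F xs)))
        (⟪Φ xs, w - xs⟫_ℝ + 1 * (G w - (Us - F xs))) 0 :=
      (hasDerivAt_comp_line (by simpa using hΦ xs hxsK)).add ((hasDerivAt_id (0 : ℝ)).mul_const _)
    have h2 := deriv_nonneg_of_le h1 fun t ht0 ht1 => by
      have hlim : Tendsto (fun n => F (x n + t • (w - x n)) + ((1 - t) * G (x n) + t * G w)) atTop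
          (𝓝 (F (xs + t • (w - xs)) + ((1 - t) * (Us - F xs) + t * G w))) := by
        refine Tendsto.add ?_ ((hGlim.const_mul _).add_const _)
        exact (hΦ _ (line_mem hG.1 hxsK hw ht0.le ht1)).continuousAt.tendsto.comp
          (hxs.add ((tendsto_const_nhds.sub hxs).const_smul t))
      have h3 : Us ≤ F (xs + t • (w - xs)) + ((1 - t) * (Us - F xs) + t * G w) := by
        refine ge_of_tendsto' hlim fun n => ?_
        have h4 := hG.2 (hxK n) hw (sub_nonneg.2 ht1) ht0.le (sub_add_cancel 1 t)
        have he : (1 - t) • x n + t • w = x n + t • (w - x n) := by module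
        rw [he] at h4
        simp only [smul_eq_mul] at h4
        have := hlb _ (line_mem hG.1 (hxK n) hw ht0.le ht1)
        linarith
      simp only [zero_smul, add_zero, zero_mul]
      linarith
    simpa using h2
  · have hlim : Tendsto (fun n => ⟪p, x n - z⟫_ℝ + (G (x n) - b)) atTop
        (𝓝 (⟪p, xs - z⟫_ℝ + (Us - F xs - b))) :=
      (tendsto_const_nhds.inner (hxs.sub_const z)).add (hGlim.sub_const b)
    exact ge_of_tendsto' hlim fun n => h _ (hxK n)

/-- A strongly convex function plus a function with an affine minorant is bounded below. -/
lemma bddBelow_of_minorant (hμ : 0 < μ) (hF : FirstOrderLB K F Φ μ) {p z : Vec d} (hz : z ∈ K)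
    (h : ∀ w ∈ K, 0 ≤ ⟪p, w - z⟫_ℝ + (G w - G z)) :
    BddBelow ((fun x => F x + G x) '' K) := by
  refine ⟨F z + G z - ‖Φ z - p‖ ^ 2 / (2 * μ), ?_⟩
  rintro _ ⟨w, hw, rfl⟩
  have h1 := hF z hz w hw
  have h2 := h w hw
  have h3 : -(‖Φ z - p‖ * ‖w - z‖) ≤ ⟪Φ z - p, w - z⟫_ℝ :=
    neg_le_of_abs_le (abs_real_inner_le_norm _ _)
  rw [inner_sub_left] at h3
  have h4 : 0 ≤ μ / 2 * (‖w - z‖ - ‖Φ z - p‖ / μ) ^ 2 := by positivity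
  have h5 : μ / 2 * (‖w - z‖ - ‖Φ z - p‖ / μ) ^ 2
      = μ / 2 * ‖w - z‖ ^ 2 - ‖Φ z - p‖ * ‖w - z‖ + ‖Φ z - p‖ ^ 2 / (2 * μ) := by
    field_simp; ring
  change F z + G z - ‖Φ z - p‖ ^ 2 / (2 * μ) ≤ F w + G w
  linarith

end Minimizer

/-! ### One local optimization step -/

section LocalStep

variable {d : ℕ} {K : Set (Vec d)} {F G g : Vec d → ℝ} {Φ Ψ : Vec d → Vec d} {x z y : Vec d}

/-- Descent of `F + G` along the direction `z - x`, where `z` minimizes the model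
`g + ⟪y - Ψ x, ·⟫ + G` and `g` is strongly convex with `g - F` of curvature at least `a`.  The vector
`y` estimates the gradient `Φ x` of `F`. -/
lemma descent_step (hG : ConvexOn ℝ K G) {mg a α : ℝ} (hg : FirstOrderLB K g Ψ mg)
    (hgF : FirstOrderLB K (fun w => g w - F w) (fun w => Ψ w - Φ w) a)
    (hx : x ∈ K) (hz : z ∈ K)
    (hvi : ∀ w ∈ K, 0 ≤ ⟪Ψ z - Ψ x + y, w - z⟫_ℝ + (G w - G z)) (hα0 : 0 ≤ α) (hα1 : α < 1) :
    F (x + α • (z - x)) + G (x + α • (z - x)) ≤ F x + G x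
      - α * (((1 - α / 2) * mg + a / 2 * α) * ‖z - x‖ ^ 2) + α * ⟪Φ x - y, z - x⟫_ℝ := by
  set e := z - x with he
  have hw := line_mem hG.1 hx hz hα0 hα1.le
  rw [← he] at hw
  set w := x + α • e with hwdef
  have e1 : w - x = α • e := by rw [hwdef]; abel
  have e2 : x - w = -(α • e) := by rw [hwdef]; abel
  have e3 : z - w = (1 - α) • e := by rw [hwdef, he]; module
  have e4 : x - z = -e := by rw [he]; abel
  have h1 := hgF x hx w hw
  have h2 := hg w hw x hx
  have h3 := hg.inner_sub_ge hw hz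
  have h4 := hvi x hx
  have h5 := hG.2 hx hz (sub_nonneg.2 hα1.le) hα0 (sub_add_cancel 1 α)
  have h6 : (1 - α) • x + α • z = w := by rw [hwdef, he]; module
  rw [h6] at h5
  rw [e1, norm_smul, real_inner_smul_right, Real.norm_of_nonneg hα0] at h1
  rw [e2, norm_neg, norm_smul, inner_neg_right, real_inner_smul_right,
    Real.norm_of_nonneg hα0] at h2
  rw [e3, norm_smul, real_inner_smul_right, Real.norm_of_nonneg (sub_nonneg.2 hα1.le)] at h3
  rw [e4, inner_neg_right] at h4
  simp only [inner_sub_left, inner_add_left, smul_eq_mul] at h1 h2 h3 h4 h5 ⊢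
  have h3' : mg * (1 - α) * ‖e‖ ^ 2 ≤ ⟪Ψ z, e⟫_ℝ - ⟪Ψ w, e⟫_ℝ := by
    have hpos : 0 < 1 - α := sub_pos.2 hα1
    refine le_of_mul_le_mul_left ?_ hpos
    linarith
  have h3'' := mul_le_mul_of_nonneg_left h3' hα0
  have h4' := mul_le_mul_of_nonneg_left h4 hα0
  linear_combination h1 + h2 + h3'' + h4' + h5

/-- Optimality gap at the minimizer `z` of the model. -/
lemma gap_step {μ D Gs : ℝ} {xs : Vec d} (hμ : 0 < μ) (hF : FirstOrderLB K F Φ μ)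
    (hxs : xs ∈ K) (hz : z ∈ K)
    (hvi : 0 ≤ ⟪Ψ z - Ψ x + y, xs - z⟫_ℝ + (Gs - G z))
    (hlip : ‖(Ψ z - Φ z) - (Ψ x - Φ x)‖ ≤ D * ‖z - x‖) :
    F z + G z - (F xs + Gs) ≤ 1 / μ * (D ^ 2 * ‖z - x‖ ^ 2 + ‖Φ x - y‖ ^ 2) := by
  have h1 := hF z hz xs hxs
  set v := (Ψ z - Φ z) - (Ψ x - Φ x) with hv
  have h2 : ⟪Ψ z - Ψ x + y, xs - z⟫_ℝ = ⟪Φ z, xs - z⟫_ℝ + ⟪v - (Φ x - y), xs - z⟫_ℝ := by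
    rw [← inner_add_left, hv]; congr 1; abel
  have h3 : ⟪v - (Φ x - y), xs - z⟫_ℝ ≤ ‖v - (Φ x - y)‖ * ‖xs - z‖ := real_inner_le_norm _ _
  have h4 : ‖v - (Φ x - y)‖ ^ 2 ≤ 2 * (D ^ 2 * ‖z - x‖ ^ 2 + ‖Φ x - y‖ ^ 2) := by
    have h5 := norm_sub_le v (Φ x - y)
    have h6 : ‖v‖ ^ 2 ≤ (D * ‖z - x‖) ^ 2 := by gcongr
    have h7 : ‖v - (Φ x - y)‖ ^ 2 ≤ (‖v‖ + ‖Φ x - y‖) ^ 2 := by gcongr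
    nlinarith [sq_nonneg (‖v‖ - ‖Φ x - y‖)]
  set s := ‖v - (Φ x - y)‖
  have h5 : s * ‖xs - z‖ - μ / 2 * ‖xs - z‖ ^ 2 ≤ 1 / (2 * μ) * s ^ 2 := by
    have h6 : 0 ≤ μ / 2 * (‖xs - z‖ - s / μ) ^ 2 := by positivity
    have h7 : μ / 2 * (‖xs - z‖ - s / μ) ^ 2
        = μ / 2 * ‖xs - z‖ ^ 2 - s * ‖xs - z‖ + 1 / (2 * μ) * s ^ 2 := by field_simp; ring
    linarith
  have h6 : 1 / (2 * μ) * s ^ 2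
      ≤ 1 / (2 * μ) * (2 * (D ^ 2 * ‖z - x‖ ^ 2 + ‖Φ x - y‖ ^ 2)) :=
    mul_le_mul_of_nonneg_left h4 (by positivity)
  have h7 : 1 / (2 * μ) * (2 * (D ^ 2 * ‖z - x‖ ^ 2 + ‖Φ x - y‖ ^ 2))
      = 1 / μ * (D ^ 2 * ‖z - x‖ ^ 2 + ‖Φ x - y‖ ^ 2) := by field_simp
  linarith

/-- Distance of the minimizer of the model to the limit minimizer. -/
lemma dist_step {mg D Gs : ℝ} {xs : Vec d} (hmg : 0 < mg) (hg : FirstOrderLB K g Ψ mg)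
    (hxs : xs ∈ K) (hz : z ∈ K)
    (hvi : 0 ≤ ⟪Ψ z - Ψ x + y, xs - z⟫_ℝ + (Gs - G z))
    (hopt : 0 ≤ ⟪Φ xs, z - xs⟫_ℝ + (G z - Gs))
    (hlip : ‖(Ψ x - Φ x) - (Ψ xs - Φ xs)‖ ≤ D * ‖x - xs‖) :
    ‖z - x‖ ≤ (D / mg + 1) * ‖x - xs‖ + ‖Φ x - y‖ / mg := by
  have h1 := hg.inner_sub_ge hxs hz
  set v := (Ψ x - Φ x) - (Ψ xs - Φ xs) with hv
  have h2 : ⟪Ψ z - Ψ x + y, xs - z⟫_ℝ = - ⟪Ψ z - Ψ x + y, z - xs⟫_ℝ := by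
    rw [← inner_neg_right, neg_sub]
  have h3 : ⟪Ψ z - Ψ xs, z - xs⟫_ℝ
      = ⟪Ψ z - Ψ x + y, z - xs⟫_ℝ - ⟪Φ xs, z - xs⟫_ℝ + ⟪v + (Φ x - y), z - xs⟫_ℝ := by
    rw [← inner_sub_left, ← inner_add_left, hv]; congr 1; abel
  have h4 : ⟪v + (Φ x - y), z - xs⟫_ℝ ≤ (D * ‖x - xs‖ + ‖Φ x - y‖) * ‖z - xs‖ :=
    (real_inner_le_norm _ _).trans (mul_le_mul_of_nonneg_right
      ((norm_add_le _ _).trans (add_le_add_left hlip _)) (norm_nonneg _))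
  have h5 : mg * ‖z - xs‖ ≤ D * ‖x - xs‖ + ‖Φ x - y‖ := by
    rcases (norm_nonneg (z - xs)).eq_or_lt with h0 | h0
    · rw [← h0, mul_zero]
      exact add_nonneg ((norm_nonneg _).trans hlip) (norm_nonneg _)
    · refine le_of_mul_le_mul_right ?_ h0
      nlinarith
  have h6 : ‖z - xs‖ ≤ (D * ‖x - xs‖ + ‖Φ x - y‖) / mg := by
    rw [le_div_iff₀ hmg, mul_comm]; exact h5
  have h7 : ‖z - x‖ ≤ ‖z - xs‖ + ‖x - xs‖ := by
    rw [norm_sub_rev x xs]; exact norm_sub_le_norm_sub_add_norm_sub z xs x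
  calc ‖z - x‖ ≤ (D * ‖x - xs‖ + ‖Φ x - y‖) / mg + ‖x - xs‖ := by linarith
    _ = _ := by ring

/-- One step contracts the optimality gap up to the gradient error.  With `u`, `u'` the gaps before
and after the step, `e` the length of the direction and `δ` the gradient error, `h1` is the descent
inequality and `h2` the bound of the gap by strong convexity; `e` is eliminated between them. -/
lemma contraction_of_descent {u u' e δ α μ D κ : ℝ} (hα : 0 < α) (hμ : 0 < μ) (hκ : 0 < κ)
    (h1 : u' ≤ u - α * (κ * e ^ 2) + α * (δ * e))
    (h2 : u' ≤ (1 - α) * u + α * (1 / μ * (D ^ 2 * e ^ 2 + δ ^ 2))) :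
    u' ≤ (1 - α * (μ * κ / (μ * κ + 2 * D ^ 2))) * u
      + α * (μ * κ / (μ * κ + 2 * D ^ 2)) * ((D ^ 2 / μ + 1 / μ * κ ^ 2) / κ ^ 2) * δ ^ 2 := by
  have h3 : α * (κ / 2 * e ^ 2) ≤ u - u' + α * (δ ^ 2 / (2 * κ)) := by
    have h4 : 0 ≤ α * (κ / 2 * (e - δ / κ) ^ 2) := by positivity
    have h5 : α * (κ / 2 * (e - δ / κ) ^ 2)
        = α * (κ / 2 * e ^ 2) - α * (δ * e) + α * (δ ^ 2 / (2 * κ)) := by field_simp; ring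
    linarith
  have hq : 0 < μ * κ + 2 * D ^ 2 := by positivity
  have h4 := mul_le_mul_of_nonneg_left h3 (by positivity : 0 ≤ 2 * D ^ 2 / κ)
  have h5 := mul_le_mul_of_nonneg_left h2 hμ.le
  have h6 : μ * ((1 - α) * u + α * (1 / μ * (D ^ 2 * e ^ 2 + δ ^ 2)))
      = μ * ((1 - α) * u) + α * (D ^ 2 * e ^ 2 + δ ^ 2) := by field_simp
  have h7 : 2 * D ^ 2 / κ * (α * (κ / 2 * e ^ 2)) = α * (D ^ 2 * e ^ 2) := by field_simp
  have h8 : (μ + 2 * D ^ 2 / κ) * u' ≤ (μ + 2 * D ^ 2 / κ - α * μ) * u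
      + α * (D ^ 2 / κ ^ 2 + 1) * δ ^ 2 := by
    have h9 : 2 * D ^ 2 / κ * (u - u' + α * (δ ^ 2 / (2 * κ)))
        = 2 * D ^ 2 / κ * (u - u') + α * (D ^ 2 / κ ^ 2 * δ ^ 2) := by field_simp
    linarith
  have h10 : 0 < μ + 2 * D ^ 2 / κ := by positivity
  refine le_of_mul_le_mul_left (h8.trans (le_of_eq ?_)) h10
  field_simp

end LocalStep

/-! ### The weights of the algorithm -/

section Network

variable {m : ℕ} {E : ℕ → Fin m → Fin m → Prop} {C : ℕ → Matrix (Fin m) (Fin m) ℝ} {cl : ℝ}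
  {φ : ℕ → Fin m → ℝ}

lemma Weights.nonneg (hC : Weights E C cl) (t : ℕ) (i j : Fin m) : 0 ≤ C t i j := by
  by_cases hij : i = j
  · exact hij ▸ hC.cl_pos.le.trans (hC.diag t i)
  · by_cases hE : E t j i
    · exact hC.cl_pos.le.trans (hC.edge t i j hij hE)
    · exact (hC.nonedge t i j hij hE).ge

lemma Weights.compatible (hC : Weights E C cl) : Compatible E C cl :=
  ⟨hC.cl_pos, hC.nonneg, hC.diag, hC.edge⟩

lemma Weights.cl_le_one (hC : Weights E C cl) (i : Fin m) : cl ≤ 1 := by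
  refine (hC.diag 0 i).trans ?_
  rw [← hC.col_sum 0 i]
  exact Finset.single_le_sum (f := fun k => C 0 k i) (fun k _ => hC.nonneg 0 k i)
    (Finset.mem_univ i)

lemma Weights.sum_smul {V : Type*} [AddCommGroup V] [Module ℝ V] (hC : Weights E C cl) (t : ℕ)
    (v : Fin m → V) : ∑ i, ∑ j, C t i j • v j = ∑ j, v j := by
  rw [Finset.sum_comm]
  simp [← Finset.sum_smul, hC.col_sum]

lemma phi_sum (hC : Weights E C cl) (hφ0 : ∀ i, φ 0 i = 1)
    (hφ : ∀ ν i, φ (ν + 1) i = ∑ j, C ν i j * φ ν j) (ν : ℕ) : ∑ i, φ ν i = m := by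
  induction ν with
  | zero => simp [hφ0]
  | succ ν ih =>
    rw [← ih, ← hC.sum_smul ν (φ ν)]
    exact Finset.sum_congr rfl fun i _ => hφ ν i

lemma phi_nonneg (hC : Weights E C cl) (hφ0 : ∀ i, φ 0 i = 1)
    (hφ : ∀ ν i, φ (ν + 1) i = ∑ j, C ν i j * φ ν j) (ν : ℕ) (i : Fin m) : 0 ≤ φ ν i := by
  induction ν generalizing i with
  | zero => simp [hφ0]
  | succ ν ih =>
    rw [hφ]
    exact Finset.sum_nonneg fun j _ => mul_nonneg (hC.nonneg _ _ _) (ih j)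

lemma phi_add (hφ : ∀ ν i, φ (ν + 1) i = ∑ j, C ν i j * φ ν j) (s n : ℕ) :
    φ (s + n) = mix (backProd C s n) (φ s) := by
  induction n with
  | zero => rw [backProd, mix_one, add_zero]
  | succ n ih =>
    rw [backProd, mix_mul, ← ih]
    funext i
    exact hφ (s + n) i

lemma phi_lower (hC : Weights E C cl) (hφ0 : ∀ i, φ 0 i = 1)
    (hφ : ∀ ν i, φ (ν + 1) i = ∑ j, C ν i j * φ ν j) {B : ℕ} (hE : StronglyConnected E B)
    (hm : 2 ≤ m) (ν : ℕ) (i : Fin m) : cl ^ (2 * (m - 1) * B) ≤ φ ν i := by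
  have hcl := hC.cl_pos
  have hcl1 := hC.cl_le_one i
  have hN : 2 * (m - 1) * B = (m - 1) * B + (m - 1) * B := by ring
  have hNB : B ≤ (m - 1) * B := Nat.le_mul_of_pos_left B (by omega)
  have hgrow : ∀ s n, cl ^ n * φ s i ≤ φ (s + n) i := by
    intro s n
    rw [phi_add hφ]
    refine le_trans (mul_le_mul_of_nonneg_right
      (hC.compatible.pow_le_backProd_self s n i) (phi_nonneg hC hφ0 hφ s i)) ?_
    exact Finset.single_le_sum (f := fun j => backProd C s n i j • φ s j)
      (fun j _ => mul_nonneg (hC.compatible.backProd_nonneg s n i j)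
        (phi_nonneg hC hφ0 hφ s j)) (Finset.mem_univ i)
  rcases le_or_gt ((m - 1) * B) ν with h | h
  · -- the last `m - 1` complete windows before time `ν`
    have hq : m - 1 ≤ ν / B := (Nat.le_div_iff_mul_le hE.1).2 h
    obtain ⟨k, hk⟩ := Nat.exists_eq_add_of_le' hq
    have hν : ν = k * B + (m - 1) * B + ν % B := by
      rw [← add_mul, ← hk, Nat.div_add_mod']
    have h1 : cl ^ ((m - 1) * B) ≤ φ (k * B + (m - 1) * B) i := by
      rw [phi_add hφ]
      have h2 : cl ^ ((m - 1) * B) * (m : ℝ) ≤ mix (backProd C (k * B) ((m - 1) * B)) (φ (k * B)) i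
          := by
        rw [← phi_sum hC hφ0 hφ (k * B), Finset.mul_sum]
        exact Finset.sum_le_sum fun j _ => mul_le_mul_of_nonneg_right
          (hC.compatible.pow_le_backProd hE k i j) (phi_nonneg hC hφ0 hφ _ j)
      refine le_trans ?_ h2
      exact le_mul_of_one_le_right (by positivity) (by exact_mod_cast (by omega : 1 ≤ m))
    have h3 := hgrow (k * B + (m - 1) * B) (ν % B)
    rw [← hν] at h3
    refine le_trans ?_ h3
    rw [hN, pow_add]
    refine mul_le_mul (pow_le_pow_of_le_one hcl.le hcl1 ?_) h1 (by positivity) (by positivity)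
    exact (Nat.mod_lt ν hE.1).le.trans hNB
  · have h3 := hgrow 0 ν
    rw [hφ0, mul_one, zero_add] at h3
    exact (pow_le_pow_of_le_one hcl.le hcl1 (by omega)).trans h3

lemma phi_upper (hC : Weights E C cl) (hφ0 : ∀ i, φ 0 i = 1)
    (hφ : ∀ ν i, φ (ν + 1) i = ∑ j, C ν i j * φ ν j) {B : ℕ} (hE : StronglyConnected E B)
    (hm : 2 ≤ m) (ν : ℕ) (i : Fin m) : φ ν i ≤ m - cl ^ (2 * (m - 1) * B) := by
  obtain ⟨k, hk⟩ : ∃ k : Fin m, k ≠ i := by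
    have : Nontrivial (Fin m) := Fin.nontrivial_iff_two_le.2 hm
    exact exists_ne i
  have h1 : φ ν k + φ ν i ≤ m := by
    rw [← phi_sum hC hφ0 hφ ν, ← Finset.sum_pair hk]
    exact Finset.sum_le_sum_of_subset_of_nonneg (Finset.subset_univ _)
      fun j _ _ => phi_nonneg hC hφ0 hφ ν j
  linarith [phi_lower hC hφ0 hφ hE hm ν k]

/-- The row stochastic matrices that govern the averaging of the iterates. -/
noncomputable def rowWeights (C : ℕ → Matrix (Fin m) (Fin m) ℝ) (φ : ℕ → Fin m → ℝ) (ν : ℕ) :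
    Matrix (Fin m) (Fin m) ℝ := fun i j => C ν i j * φ ν j / φ (ν + 1) i

lemma rowWeights_rowStochastic (hC : Weights E C cl)
    (hφ : ∀ ν i, φ (ν + 1) i = ∑ j, C ν i j * φ ν j) (hpos : ∀ ν i, 0 < φ ν i) (ν : ℕ) :
    RowStochastic (rowWeights C φ ν) where
  nonneg i j := div_nonneg (mul_nonneg (hC.nonneg _ _ _) (hpos _ _).le) (hpos _ _).le
  row_sum i := by
    simp only [rowWeights]
    rw [← Finset.sum_div, ← hφ, div_self (hpos _ _).ne']

lemma rowWeights_compatible (hC : Weights E C cl) (hφ0 : ∀ i, φ 0 i = 1)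
    (hφ : ∀ ν i, φ (ν + 1) i = ∑ j, C ν i j * φ ν j) {B : ℕ} (hE : StronglyConnected E B)
    (hm : 2 ≤ m) :
    Compatible E (rowWeights C φ) (cl ^ (2 * (m - 1) * B + 1) / (m : ℝ)) := by
  have hcl := hC.cl_pos
  have hm0 : (0 : ℝ) < m := by exact_mod_cast (by omega : 0 < m)
  have hpos : ∀ ν i, 0 < φ ν i := fun ν i =>
    (pow_pos hcl _).trans_le (phi_lower hC hφ0 hφ hE hm ν i)
  have hle : ∀ ν i, φ ν i ≤ m := fun ν i => (phi_upper hC hφ0 hφ hE hm ν i).trans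
    (sub_le_self _ (by positivity))
  have key : ∀ ν i j, cl ≤ C ν i j →
      cl ^ (2 * (m - 1) * B + 1) / (m : ℝ) ≤ rowWeights C φ ν i j := fun ν i j h => by
    rw [pow_succ']
    exact div_le_div₀ (mul_nonneg (hC.nonneg _ _ _) (hpos _ _).le)
      (mul_le_mul h (phi_lower hC hφ0 hφ hE hm ν j) (by positivity) (hC.nonneg _ _ _))
      (hpos _ _) (hle _ _)
  exact ⟨by positivity, fun t => (rowWeights_rowStochastic hC hφ hpos t).nonneg,
    fun t i => key t i i (hC.diag t i), fun t i j hij h => key t i j (hC.edge t i j hij h)⟩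

end Network

/-! ### The constants -/

namespace Consts

variable {m : ℕ} (c : Consts m)

lemma clt_pow_bounds (hm : 2 ≤ m) (hB : 0 < c.B) (h0 : 0 < c.cl) (h1 : c.cl ≤ 1) :
    0 < c.clt ^ ((m - 1) * c.B) ∧ c.clt ^ ((m - 1) * c.B) ≤ 1 / 2 := by
  have hm2 : (2 : ℝ) ≤ m := by exact_mod_cast hm
  have hpos : 0 < c.clt := by unfold clt; positivity
  have hle : c.clt ≤ 1 / 2 := by
    unfold clt
    rw [div_le_div_iff₀ (by positivity) (by norm_num)]
    have := pow_le_one₀ (n := 2 * (m - 1) * c.B + 1) h0.le h1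
    linarith
  refine ⟨by positivity, (pow_le_of_le_one hpos.le (by linarith) ?_).trans hle⟩
  exact (Nat.mul_pos (by omega) hB).ne'

lemma rhoB_spec (hm : 2 ≤ m) (hB : 0 < c.B) (h0 : 0 < c.cl) (h1 : c.cl ≤ 1) :
    0 < c.rhoB ∧ c.rhoB < 1 ∧ c.rhoB ^ ((m - 1) * c.B) = 1 - c.clt ^ ((m - 1) * c.B) := by
  obtain ⟨he0, he1⟩ := c.clt_pow_bounds hm hB h0 h1
  have hN : 0 < (m - 1) * c.B := Nat.mul_pos (by omega) hB
  refine ⟨Real.rpow_pos_of_pos (by linarith) _,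
    Real.rpow_lt_one (by linarith) (by linarith) (by positivity), ?_⟩
  unfold rhoB
  rw [one_div, Real.rpow_inv_natCast_pow (by linarith) hN.ne']

/-- The constant `c0` absorbs the constants of the consensus bound. -/
lemma le_c0_sq (hm : 2 ≤ m) (hB : 0 < c.B) (h0 : 0 < c.cl) (h1 : c.cl ≤ 1) :
    2 * m * (((1 - c.clt ^ ((m - 1) * c.B)) ^ 2)⁻¹) ^ 2 ≤ c.c0 ^ 2 := by
  obtain ⟨he0, he1⟩ := c.clt_pow_bounds hm hB h0 h1
  unfold c0
  set e := c.clt ^ ((m - 1) * c.B)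
  have hm2 : (2 : ℝ) ≤ m := by exact_mod_cast hm
  have hs : 0 < 1 - e := by linarith
  have h2 : 2 * (m : ℝ) * ((1 + e⁻¹) / (1 - e⁻¹)) = -(2 * m * (1 + e) / (1 - e)) := by
    have h3 : 1 - e⁻¹ = -((1 - e) / e) := by field_simp; ring
    have h4 : 1 + e⁻¹ = (1 + e) / e := by field_simp; ring
    rw [h3, h4]
    field_simp
  rw [h2, neg_sq, div_pow, inv_pow, ← div_eq_mul_inv, div_le_div_iff₀ (by positivity) (by positivity)]
  have h5 : (3 / 4 : ℝ) ≤ (1 + e) * (1 - e) := by nlinarith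
  have h6 : (3 / 4 : ℝ) ^ 2 ≤ ((1 + e) * (1 - e)) ^ 2 := by gcongr
  have h7 : 1 ≤ 2 * m * ((1 + e) * (1 - e)) ^ 2 := by nlinarith
  have h8 := mul_le_mul_of_nonneg_left h7 (by positivity : 0 ≤ 2 * (m : ℝ) * (1 - e) ^ 2)
  linarith

lemma Lmax_ge (i : Fin m) : c.Ls i ≤ c.Lmax := le_ciSup (Set.finite_range _).bddAbove i

lemma musMin_le (i : Fin m) : c.musMin ≤ c.mus i := ciInf_le (Set.finite_range _).bddBelow i

lemma DlMin_le (i : Fin m) : c.DlMin ≤ c.Dl i := ciInf_le (Set.finite_range _).bddBelow i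

lemma Dmax_ge (i : Fin m) : max |c.Dl i| |c.Du i| ≤ c.Dmax :=
  le_ciSup (f := fun i => max |c.Dl i| |c.Du i|) (Set.finite_range _).bddAbove i

lemma musMin_pos (i : Fin m) (h : ∀ i, 0 < c.mus i) : 0 < c.musMin := by
  have : Nonempty (Fin m) := ⟨i⟩
  obtain ⟨k, hk⟩ := exists_eq_ciInf_of_finite (f := c.mus)
  rw [musMin, ← hk]
  exact h k

lemma alphaMax_bounds {α : ℝ} (h : α < c.alphaMax) :
    α < (1 - c.rhoB) / c.A (1 / 2) ∧ α < 1 ∧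
      (c.DlMin < c.musMin → α < c.musMin / (c.musMin - c.DlMin)) := by
  unfold alphaMax at h
  split_ifs at h with hlt
  · exact ⟨h.trans_le (min_le_left _ _), h.trans_le ((min_le_right _ _).trans (min_le_right _ _)),
      fun _ => h.trans_le ((min_le_right _ _).trans (min_le_left _ _))⟩
  · exact ⟨h.trans_le (min_le_left _ _), h.trans_le (min_le_right _ _), fun h => absurd h hlt⟩

/-- Below the cap on the step size the effective curvature is at least half of `musMin`, and the
gain `GP` is at most `GPcap`. -/
lemma curv_bounds (hs : 0 < c.musMin) (hmu : 0 < c.mu) (hD : c.DlMin ≤ c.musMin) {α : ℝ}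
    (h : c.DlMin < c.musMin → α < c.musMin / (c.musMin - c.DlMin)) :
    c.musMin / 2 ≤ c.curv α ∧ c.GP α ≤ c.GPcap := by
  have hcap : ∃ k, c.curv (c.musMin / (c.musMin - c.DlMin)) = k ∧ c.musMin / 2 ≤ k ∧
      k ≤ c.curv α := by
    refine ⟨_, rfl, ?_⟩
    unfold curv
    rcases hD.eq_or_lt with heq | hlt
    · rw [heq]; constructor <;> nlinarith
    · have hd : 0 < c.musMin - c.DlMin := sub_pos.2 hlt
      have h1 := h hlt
      have h2 : c.musMin / (c.musMin - c.DlMin) * (c.musMin - c.DlMin) = c.musMin :=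
        div_mul_cancel₀ _ hd.ne'
      constructor <;> nlinarith
  obtain ⟨k, hk, hk1, hk2⟩ := hcap
  refine ⟨hk1.trans hk2, ?_⟩
  have hk0 : 0 < k := by linarith
  have hform : ∀ k : ℝ, 0 < k → (c.Dmax ^ 2 / c.mu + 1 / c.mu * k ^ 2) / k ^ 2
      = c.Dmax ^ 2 / c.mu / k ^ 2 + 1 / c.mu := fun k hk => by field_simp
  unfold GPcap GP
  rw [hk, hform _ hk0, hform _ (hk0.trans_le hk2)]
  gcongr

lemma J_pos (hs : 0 < c.musMin) (hmu : 0 < c.mu) : 0 < c.J := by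
  unfold J; positivity

/-- The contraction factor of the optimization step, in terms of `J`. -/
lemma two_J_le (hs : 0 < c.musMin) (hmu : 0 < c.mu) {κ : ℝ} (hκ : c.musMin / 2 ≤ κ) :
    2 * c.J ≤ c.mu * κ / (c.mu * κ + 2 * c.Dmax ^ 2) := by
  have hκ0 : 0 < κ := by linarith
  have h : 2 * c.J = c.musMin * c.mu / (4 * c.Dmax ^ 2 + c.musMin * c.mu) := by unfold J; ring
  rw [h, div_le_div_iff₀ (by positivity) (by positivity)]
  nlinarith [mul_nonneg hmu.le (mul_nonneg (sq_nonneg c.Dmax) (sub_nonneg.2 hκ))]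

/-- Up to the cap on the step size, `rate α` is the larger of `1 - J α` and `ρ_B + A α`. -/
lemma rate_spec (hρ1 : c.rhoB < 1) (hs : 0 < c.musMin) (hmu : 0 < c.mu)
    {α : ℝ} (hα : 0 < α) (hα_max : α < c.alphaMax) :
    0 < c.A (1 / 2) ∧ c.rate α < 1 ∧ 1 - c.J * α ≤ c.rate α ∧
      c.rhoB + c.A (1 / 2) * α ≤ c.rate α := by
  obtain ⟨h1, h2, -⟩ := c.alphaMax_bounds hα_max
  have hJ := c.J_pos hs hmu
  have hA : 0 < c.A (1 / 2) := by
    by_contra! h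
    have := div_nonpos_of_nonneg_of_nonpos (sub_nonneg.2 hρ1.le) h
    linarith
  rw [lt_div_iff₀ hA] at h1
  have hstar : α < c.alphaStar ↔ α * (c.A (1 / 2) + c.J) < 1 - c.rhoB :=
    lt_div_iff₀ (by positivity)
  refine ⟨hA, ?_⟩
  unfold rate
  by_cases h : α < c.alphaStar
  · rw [if_pos (lt_min h hα_max)]
    rw [hstar] at h
    have : 0 < c.J * α := by positivity
    refine ⟨by linarith, le_rfl, by nlinarith⟩
  · rw [if_neg (fun h' => h (h'.trans_le (min_le_left _ _)))]
    rw [hstar] at h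
    exact ⟨by linarith, by nlinarith, le_rfl⟩

end Consts

/-! ### First-order facts about the losses and the surrogates -/

namespace Problem

variable {m d : ℕ} {P : Problem m d} {μ L : ℝ}

lemma Regular.hasGradientAt_f (hP : P.Regular μ L) (i : Fin m) {x : Vec d} (hx : x ∈ P.O) :
    HasGradientAt (P.f i) (gradient (P.f i) x) x :=
  ((hP.f_diff i x hx).differentiableAt (hP.O_open.mem_nhds hx)).hasGradientAt

lemma Regular.hasGradientAt_F' (hP : P.Regular μ L) {x : Vec d} (hx : x ∈ P.O) :
    HasGradientAt P.F ((1 / (m : ℝ)) • ∑ i, gradient (P.f i) x) x := by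
  rw [hasGradientAt_iff_hasFDerivAt, map_smul, map_sum]
  exact (HasFDerivAt.fun_sum fun i _ =>
    hasGradientAt_iff_hasFDerivAt.1 (hP.hasGradientAt_f i hx)).const_mul (1 / (m : ℝ))

lemma Regular.gradient_F (hP : P.Regular μ L) {x : Vec d} (hx : x ∈ P.O) :
    gradient P.F x = (1 / (m : ℝ)) • ∑ i, gradient (P.f i) x :=
  (hP.hasGradientAt_F' hx).gradient

lemma Regular.hasGradientAt_F (hP : P.Regular μ L) {x : Vec d} (hx : x ∈ P.O) :
    HasGradientAt P.F (gradient P.F x) x :=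
  (hP.hasGradientAt_F' hx).differentiableAt.hasGradientAt

lemma Regular.differentiableOn_F (hP : P.Regular μ L) : DifferentiableOn ℝ P.F P.O :=
  fun _ hx => (hP.hasGradientAt_F hx).differentiableAt.differentiableWithinAt

lemma Regular.differentiableOn_gradient_F (hP : P.Regular μ L) :
    DifferentiableOn ℝ (gradient P.F) P.O := by
  refine DifferentiableOn.congr ?_ fun x hx => hP.gradient_F hx
  exact (DifferentiableOn.fun_sum fun i _ => hP.f_diff_two i).const_smul (1 / (m : ℝ))

lemma Regular.hasFDerivAt_gradient (hP : P.Regular μ L) {g : Vec d → ℝ}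
    (hg : DifferentiableOn ℝ (gradient g) P.O) {x : Vec d} (hx : x ∈ P.K) :
    HasFDerivAt (gradient g) (hess g x) x :=
  ((hg x (hP.K_subset_O hx)).differentiableAt
    (hP.O_open.mem_nhds (hP.K_subset_O hx))).hasFDerivAt

lemma Regular.firstOrderLB_F (hP : P.Regular μ L) : FirstOrderLB P.K P.F (gradient P.F) μ :=
  FirstOrderLB.of_lowerBd hP.K_convex (fun _ hx => hP.hasGradientAt_F (hP.K_subset_O hx))
    (fun _ hx => hP.hasFDerivAt_gradient hP.differentiableOn_gradient_F hx) hP.F_lower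

lemma Regular.lipschitz_f (hP : P.Regular μ L) {Ls : Fin m → ℝ} (hLs : P.SmoothConsts Ls)
    (i : Fin m) {x y : Vec d} (hx : x ∈ P.K) (hy : y ∈ P.K) :
    ‖gradient (P.f i) y - gradient (P.f i) x‖ ≤ Ls i * ‖y - x‖ := by
  refine norm_sub_le_of_symm hP.K_convex (hLs i).1.le
    (fun z hz => hP.hasFDerivAt_gradient (hP.f_diff_two i) hz)
    (fun z hz => hess_symm hP.O_open (hP.f_diff i) (hP.f_diff_two i) (hP.K_subset_O hz))
    (fun z hz v => ?_) (hLs i).2 hx hy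
  refine le_trans ?_ (hess_nonneg_of_convexOn hP.O_open (hP.f_diff i) (hP.f_diff_two i)
    (hP.f_convex i) (hP.K_subset_O hz) v)
  nlinarith [sq_nonneg ‖v‖, (hLs i).1]

variable {ft : Fin m → Vec d → Vec d → ℝ} {Lt : Fin m → ℝ≥0} {mus Dl Du : Fin m → ℝ}

lemma Surrogate.contDiffOn (hft : P.Surrogate ft Lt mus) (i : Fin m) {z : Vec d} (hz : z ∈ P.O) :
    ContDiffOn ℝ 2 (fun w => ft i w z) P.O :=
  (hft.smooth i).comp (f := fun w : Vec d => (w, z))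
    (contDiff_id.prodMk contDiff_const).contDiffOn fun _ hw => ⟨hw, hz⟩

lemma Surrogate.differentiableOn_gradient (hft : P.Surrogate ft Lt mus) (hP : P.Regular μ L)
    (i : Fin m) {z : Vec d} (hz : z ∈ P.O) :
    DifferentiableOn ℝ (gradient fun w => ft i w z) P.O := by
  have h := ((hft.contDiffOn i hz).fderiv_of_isOpen hP.O_open (m := 1) (by norm_num)).differentiableOn
    one_ne_zero
  intro x hx
  exact (InnerProductSpace.toDual ℝ (Vec d)).symm.differentiableAt.comp_differentiableWithinAt x
    (h x hx)

lemma Surrogate.hasGradientAt (hft : P.Surrogate ft Lt mus) (hP : P.Regular μ L) (i : Fin m)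
    {z x : Vec d} (hz : z ∈ P.O) (hx : x ∈ P.O) :
    HasGradientAt (fun w => ft i w z) (gradient (fun w => ft i w z) x) x :=
  (((hft.contDiffOn i hz).differentiableOn two_ne_zero x hx).differentiableAt
    (hP.O_open.mem_nhds hx)).hasGradientAt

lemma Surrogate.firstOrderLB (hft : P.Surrogate ft Lt mus) (hP : P.Regular μ L) (i : Fin m)
    {z : Vec d} (hz : z ∈ P.K) :
    FirstOrderLB P.K (fun w => ft i w z) (gradient fun w => ft i w z) (mus i) :=
  FirstOrderLB.of_strongConvexOn (hft.strong i z hz) fun _ hx =>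
    hft.hasGradientAt hP i (hP.K_subset_O hz) (hP.K_subset_O hx)

lemma Surrogate.firstOrderLB_sub (hft : P.Surrogate ft Lt mus) (hP : P.Regular μ L)
    (hD : P.HessGap ft Dl Du) (i : Fin m) {z : Vec d} (hz : z ∈ P.K) :
    FirstOrderLB P.K (fun w => ft i w z - P.F w)
      (fun w => gradient (fun w => ft i w z) w - gradient P.F w) (Dl i) := by
  refine FirstOrderLB.of_lowerBd hP.K_convex (fun x hx => ?_) (fun x hx => ?_)
    (fun x hx => ((hD i).2 x hx z hz).1)
  · rw [hasGradientAt_iff_hasFDerivAt, map_sub]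
    exact (hasGradientAt_iff_hasFDerivAt.1
      (hft.hasGradientAt hP i (hP.K_subset_O hz) (hP.K_subset_O hx))).sub
      (hasGradientAt_iff_hasFDerivAt.1 (hP.hasGradientAt_F (hP.K_subset_O hx)))
  · exact (hP.hasFDerivAt_gradient
      (hft.differentiableOn_gradient hP i (hP.K_subset_O hz)) hx).sub
      (hP.hasFDerivAt_gradient hP.differentiableOn_gradient_F hx)

lemma Surrogate.lipschitz_sub (hft : P.Surrogate ft Lt mus) (hP : P.Regular μ L)
    (hD : P.HessGap ft Dl Du) (i : Fin m) {D : ℝ} (hDi : max |Dl i| |Du i| ≤ D) {x y z : Vec d}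
    (hx : x ∈ P.K) (hy : y ∈ P.K) (hz : z ∈ P.K) :
    ‖(gradient (fun w => ft i w z) y - gradient P.F y)
      - (gradient (fun w => ft i w z) x - gradient P.F x)‖ ≤ D * ‖y - x‖ := by
  have hl : -D ≤ Dl i := neg_le_of_abs_le ((le_max_left _ _).trans hDi)
  have hu : Du i ≤ D := le_of_abs_le ((le_max_right _ _).trans hDi)
  have hD0 : 0 ≤ D := (abs_nonneg _).trans ((le_max_left _ _).trans hDi)
  have hzO := hP.K_subset_O hz
  refine norm_sub_le_of_symm
    (Φ := fun w => gradient (fun w => ft i w z) w - gradient P.F w) hP.K_convex hD0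
    (fun w hw => (hP.hasFDerivAt_gradient (hft.differentiableOn_gradient hP i hzO) hw).sub
      (hP.hasFDerivAt_gradient hP.differentiableOn_gradient_F hw))
    (fun w hw u v => ?_) (fun w hw v => ?_) (fun w hw v => ?_) hx hy
  · rw [_root_.sub_apply, _root_.sub_apply, inner_sub_left,
      inner_sub_right, hess_symm hP.O_open ((hft.contDiffOn i hzO).differentiableOn two_ne_zero)
        (hft.differentiableOn_gradient hP i hzO) (hP.K_subset_O hw),
      hess_symm hP.O_open hP.differentiableOn_F hP.differentiableOn_gradient_F
        (hP.K_subset_O hw)]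
  · exact (mul_le_mul_of_nonneg_right hl (by positivity)).trans (((hD i).2 w hw z hz).1 v)
  · exact (((hD i).2 w hw z hz).2 v).trans (mul_le_mul_of_nonneg_right hu (by positivity))

end Problem

/-! ### Properties of a run -/

namespace IsRun

variable {m d : ℕ} {P : Problem m d} {μ L : ℝ} {ft : Fin m → Vec d → Vec d → ℝ}
  {Lt : Fin m → ℝ≥0} {mus : Fin m → ℝ} {E : ℕ → Fin m → Fin m → Prop}
  {C : ℕ → Matrix (Fin m) (Fin m) ℝ} {cl α : ℝ} {T : Trajectory m d}

lemma x_succ_eq (hT : IsRun P ft C α T) (ν : ℕ) :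
    T.x (ν + 1) = mix (rowWeights C T.phi ν) (T.xhalf ν) := by
  funext i
  rw [hT.x_succ, mix, Finset.smul_sum]
  refine Finset.sum_congr rfl fun j _ => ?_
  rw [smul_smul, rowWeights]
  congr 1; ring

lemma xhalf_eq_add (hT : IsRun P ft C α T) (ν : ℕ) :
    T.xhalf ν = T.x ν + fun i => α • (T.xhat ν i - T.x ν i) :=
  funext (hT.xhalf_eq ν)

lemma y_succ_eq (hT : IsRun P ft C α T) (hpos : ∀ ν i, 0 < T.phi ν i) (ν : ℕ) :
    T.y (ν + 1) = mix (rowWeights C T.phi ν) (T.y ν + fun j => (1 / T.phi ν j) •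
      (gradient (P.f j) (T.x (ν + 1) j) - gradient (P.f j) (T.x ν j))) := by
  funext i
  rw [hT.y_succ, mix, Finset.smul_sum]
  refine Finset.sum_congr rfl fun j _ => ?_
  have := (hpos ν j).ne'
  rw [Pi.add_apply, rowWeights, smul_add, smul_add, smul_add, smul_smul, smul_smul, smul_smul,
    smul_smul]
  congr 2 <;> field_simp

/-- Gradient tracking: the weighted sum of the `y` variables is the sum of the local gradients. -/
lemma sum_phi_smul_y (hT : IsRun P ft C α T) (hC : Weights E C cl)
    (hpos : ∀ ν i, 0 < T.phi ν i) (ν : ℕ) :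
    ∑ i, T.phi ν i • T.y ν i = ∑ i, gradient (P.f i) (T.x ν i) := by
  induction ν with
  | zero =>
    refine Finset.sum_congr rfl fun i _ => ?_
    rw [hT.phi_init, one_smul, hT.y_init]
  | succ ν ih =>
    have h : ∀ i, T.phi (ν + 1) i • T.y (ν + 1) i = ∑ j, C ν i j •
        (T.phi ν j • T.y ν j
        + (gradient (P.f j) (T.x (ν + 1) j) - gradient (P.f j) (T.x ν j))) := fun i => by
      rw [hT.y_succ, smul_smul, mul_one_div_cancel (hpos _ _).ne', one_smul]
    simp_rw [h]
    rw [hC.sum_smul, Finset.sum_add_distrib, ih, ← Finset.sum_add_distrib]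
    exact Finset.sum_congr rfl fun i _ => by abel

lemma xhalf_mem (hT : IsRun P ft C α T) (hP : P.Regular μ L) (hα0 : 0 ≤ α) (hα1 : α ≤ 1)
    {ν : ℕ} (hx : ∀ i, T.x ν i ∈ P.K) (i : Fin m) : T.xhalf ν i ∈ P.K := by
  rw [hT.xhalf_eq]
  exact line_mem hP.K_convex (hx i) (hT.xhat_mem ν i) hα0 hα1

lemma x_mem (hT : IsRun P ft C α T) (hP : P.Regular μ L) (hα0 : 0 ≤ α) (hα1 : α ≤ 1)
    (hW : ∀ ν, RowStochastic (rowWeights C T.phi ν)) (ν : ℕ) (i : Fin m) : T.x ν i ∈ P.K := by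
  induction ν generalizing i with
  | zero => exact hT.x_init i
  | succ ν ih =>
    rw [hT.x_succ_eq]
    exact hP.K_convex.sum_mem (fun j _ => (hW ν).nonneg i j) ((hW ν).row_sum i)
      fun j _ => hT.xhalf_mem hP hα0 hα1 ih j

lemma variational (hT : IsRun P ft C α T) (hP : P.Regular μ L) (hft : P.Surrogate ft Lt mus)
    {ν : ℕ} {i : Fin m} (hx : T.x ν i ∈ P.K) {w : Vec d} (hw : w ∈ P.K) :
    0 ≤ ⟪gradient (fun w => ft i w (T.x ν i)) (T.xhat ν i)
        - gradient (fun w => ft i w (T.x ν i)) (T.x ν i) + T.y ν i, w - T.xhat ν i⟫_ℝ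
      + (P.G w - P.G (T.xhat ν i)) := by
  have hz := hT.xhat_mem ν i
  refine variational_of_isMinOn hP.G_convex (h := fun w => ft i w (T.x ν i)
      + ⟪T.y ν i - gradient (P.f i) (T.x ν i), w - T.x ν i⟫_ℝ) hz ?_
    (fun w hw => isMinOn_iff.1 (hT.xhat_min ν i) w hw) hw
  rw [hft.grad_diag i _ hx, sub_add_eq_add_sub, add_sub_assoc, hasGradientAt_iff_hasFDerivAt,
    map_add]
  have h1 := hasGradientAt_iff_hasFDerivAt.1
    (hft.hasGradientAt hP i (hP.K_subset_O hx) (hP.K_subset_O hz))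
  have h2 : HasFDerivAt
      (fun w => ⟪T.y ν i - gradient (P.f i) (T.x ν i), w - T.x ν i⟫_ℝ)
      (InnerProductSpace.toDual ℝ (Vec d) (T.y ν i - gradient (P.f i) (T.x ν i)))
      (T.xhat ν i) :=
    (InnerProductSpace.toDual ℝ (Vec d) _).hasFDerivAt.comp (T.xhat ν i)
      ((hasFDerivAt_id _).sub_const (T.x ν i))
  exact h1.add h2

end IsRun

/-! ### Linear convergence -/

/-- A small-gain argument for three coupled scalar recursions.  The bounds `P z ^ ν`, `X₀ z ^ ν` and
`Y₀ z ^ ν` are preserved by the recursions as soon as the loop from `S` to `S` has gain at most one,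
and being homogeneous they can be scaled up to hold at the start. -/
lemma geometric_of_small_gain {p X Y S : ℕ → ℝ} {σ η ρ z α q k n a b C1 C2 H : ℝ}
    (hσ : 0 ≤ σ) (hη0 : 0 ≤ η) (hα : 0 < α) (hρ : 0 ≤ ρ) (hz : ρ < z) (hz1 : z ≤ 1) (hq : 0 < q)
    (hk : 0 < k) (hn : 1 ≤ n) (ha : 0 < a) (hb : 0 < b) (hC1 : 0 ≤ C1) (hC2 : 0 ≤ C2) (hH : 0 < H)
    (hη : η ≤ H * (z - σ))
    (hp : ∀ ν, p (ν + 1) ≤ σ * p ν + η * (a * X ν + b * Y ν))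
    (hX : ∀ ν, X (ν + 1) ≤ ρ * X ν + q * (α ^ 2 * S ν))
    (hY : ∀ ν, Y (ν + 1) ≤ ρ * Y ν + q * (k * (2 * X ν + 2 * α ^ 2 * n * S ν)))
    (hS : ∀ ν, S ν ≤ C1 * p ν + C2 * Y ν)
    (hgain : α ^ 2 * (H * C1 * a * (2 * q) + (H * b * C1 + C2) * (2 * n * k) * (2 * q)
      + (H * b * C1 + C2) * (8 * n * k) * (4 * q ^ 2)) ≤ (z - ρ) ^ 2) :
    ∃ M, 0 ≤ M ∧ ∀ ν, p ν ≤ M * z ^ ν := by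
  set t := z - ρ with ht
  have ht0 : 0 < t := sub_pos.2 hz
  have ht1 : t ≤ 1 := by linarith
  have hn0 : 0 < n := by linarith
  -- the components of the positive vector, for `S` of size one
  set x1 := q * α ^ 2 / t with hx1
  set y1 := q * (k * (2 * x1 + 2 * α ^ 2 * n)) / t with hy1
  set p1 := H * (a * x1 + b * y1) with hp1
  have hx1pos : 0 < x1 := by positivity
  have hy1pos : 0 < y1 := by positivity
  have hp1pos : 0 < p1 := by positivity
  have hx1t : t * x1 = q * α ^ 2 := by rw [hx1]; field_simp
  have hy1t : t * y1 = q * (k * (2 * x1 + 2 * α ^ 2 * n)) := by rw [hy1]; field_simp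
  have hloop : C1 * p1 + C2 * y1 ≤ 1 := by
    have e1 : t ^ 2 * (C1 * p1 + C2 * y1) = H * C1 * a * (q * α ^ 2) * t
        + (H * b * C1 + C2) * (q * (k * (2 * (q * α ^ 2) + 2 * α ^ 2 * n * t))) := by
      calc t ^ 2 * (C1 * p1 + C2 * y1)
          = H * C1 * a * (t * x1) * t + (H * b * C1 + C2) * ((t * y1) * t) := by rw [hp1]; ring
        _ = H * C1 * a * (t * x1) * t
            + (H * b * C1 + C2) * (q * (k * (2 * (t * x1) + 2 * α ^ 2 * n * t))) := by
          rw [hy1t]; ring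
        _ = _ := by rw [hx1t]
    have hB0 : 0 ≤ H * b * C1 + C2 := by positivity
    have e2 : H * C1 * a * (q * α ^ 2) * t ≤ H * C1 * a * (q * α ^ 2) * 1 := by gcongr
    have e3 : (H * b * C1 + C2) * (q * (k * (2 * (q * α ^ 2) + 2 * α ^ 2 * n * t)))
        ≤ (H * b * C1 + C2) * (q * (k * (2 * (q * α ^ 2 * n) + 2 * α ^ 2 * n * 1))) := by
      have := le_mul_of_one_le_right (by positivity : 0 ≤ q * α ^ 2) hn
      gcongr
    have e4 : 0 ≤ H * C1 * a * (q * α ^ 2) := by positivity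
    have e5 : 0 ≤ (H * b * C1 + C2) * (q * (k * (α ^ 2 * n))) := by positivity
    have e6 : 0 ≤ (H * b * C1 + C2) * (q * (k * (q * α ^ 2 * n))) := by positivity
    have h : t ^ 2 * (C1 * p1 + C2 * y1) ≤ t ^ 2 * 1 := by
      rw [e1]; linarith
    exact le_of_mul_le_mul_left h (by positivity)
  set s := |p 0| / p1 + |X 0| / x1 + |Y 0| / y1 with hs
  have hs0 : 0 ≤ s := by positivity
  have hsp : |p 0| / p1 ≤ s := by
    have : 0 ≤ |X 0| / x1 := by positivity
    have : 0 ≤ |Y 0| / y1 := by positivity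
    linarith
  have hsX : |X 0| / x1 ≤ s := by
    have : 0 ≤ |p 0| / p1 := by positivity
    have : 0 ≤ |Y 0| / y1 := by positivity
    linarith
  have hsY : |Y 0| / y1 ≤ s := by
    have : 0 ≤ |p 0| / p1 := by positivity
    have : 0 ≤ |X 0| / x1 := by positivity
    linarith
  have key : ∀ ν, p ν ≤ p1 * s * z ^ ν ∧ X ν ≤ x1 * s * z ^ ν ∧ Y ν ≤ y1 * s * z ^ ν := by
    intro ν
    induction ν with
    | zero =>
      rw [div_le_iff₀' (by positivity)] at hsp hsX hsY
      simp only [pow_zero, mul_one]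
      exact ⟨(le_abs_self _).trans hsp, (le_abs_self _).trans hsX, (le_abs_self _).trans hsY⟩
    | succ ν ih =>
      obtain ⟨ip, iX, iY⟩ := ih
      have hw : 0 ≤ s * z ^ ν := mul_nonneg hs0 (pow_nonneg (by linarith) _)
      set w := s * z ^ ν with hwdef
      rw [mul_assoc, ← hwdef] at ip iX iY
      have hSw : S ν ≤ w := by
        calc S ν ≤ C1 * p ν + C2 * Y ν := hS ν
          _ ≤ C1 * (p1 * w) + C2 * (y1 * w) := by gcongr
          _ = (C1 * p1 + C2 * y1) * w := by ring
          _ ≤ 1 * w := by gcongr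
          _ = w := one_mul w
      have hsucc : s * z ^ (ν + 1) = z * w := by rw [hwdef, pow_succ]; ring
      simp only [mul_assoc, hsucc]
      refine ⟨?_, ?_, ?_⟩
      · calc p (ν + 1) ≤ σ * p ν + η * (a * X ν + b * Y ν) := hp ν
          _ ≤ σ * (p1 * w) + η * (a * (x1 * w) + b * (y1 * w)) := by gcongr
          _ ≤ σ * (p1 * w) + H * (z - σ) * (a * (x1 * w) + b * (y1 * w)) := by gcongr
          _ = p1 * (z * w) := by rw [hp1]; ring
      · calc X (ν + 1) ≤ ρ * X ν + q * (α ^ 2 * S ν) := hX ν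
          _ ≤ ρ * (x1 * w) + q * (α ^ 2 * w) := by gcongr
          _ = ρ * (x1 * w) + t * x1 * w := by rw [hx1t]; ring
          _ = x1 * (z * w) := by rw [ht]; ring
      · calc Y (ν + 1) ≤ ρ * Y ν + q * (k * (2 * X ν + 2 * α ^ 2 * n * S ν)) := hY ν
          _ ≤ ρ * (y1 * w) + q * (k * (2 * (x1 * w) + 2 * α ^ 2 * n * w)) := by gcongr
          _ = ρ * (y1 * w) + t * y1 * w := by rw [hy1t]; ring
          _ = y1 * (z * w) := by rw [ht]; ring
  exact ⟨p1 * s, by positivity, fun ν => (key ν).1⟩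

section Aggregation

variable {m d : ℕ}

lemma norm_mean_sq_le (hm : 0 < m) (v : Fin m → Vec d) :
    ‖(1 / (m : ℝ)) • ∑ j, v j‖ ^ 2 ≤ 1 / (m : ℝ) * ∑ j, ‖v j‖ ^ 2 := by
  have hm0 : (0 : ℝ) < m := by exact_mod_cast hm
  have h1 : ‖∑ j, v j‖ ^ 2 ≤ m * ∑ j, ‖v j‖ ^ 2 := by
    calc ‖∑ j, v j‖ ^ 2 ≤ (∑ j, ‖v j‖) ^ 2 := by gcongr; exact norm_sum_le _ _
      _ ≤ _ := by simpa using sq_sum_le_card_mul_sum_sq (s := Finset.univ) (f := fun j => ‖v j‖)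
  rw [norm_smul, mul_pow, Real.norm_of_nonneg (by positivity)]
  calc (1 / (m : ℝ)) ^ 2 * ‖∑ j, v j‖ ^ 2 ≤ (1 / (m : ℝ)) ^ 2 * (m * ∑ j, ‖v j‖ ^ 2) := by gcongr
    _ = _ := by field_simp

lemma spreadLE_of_sq (hm : 0 < m) {x : Fin m → Vec d} {X : ℝ}
    (hX : ∀ i j, (m : ℝ) * ‖x i - x j‖ ^ 2 ≤ X) : SpreadLE x (√(X / m)) := fun i j => by
  have hm0 : (0 : ℝ) < m := by exact_mod_cast hm
  refine Real.le_sqrt_of_sq_le ?_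
  rw [le_div_iff₀' hm0]
  exact hX i j

/-- The distance of a weighted mean of `y` to a member of the family. -/
lemma norm_weighted_mean_sub_sq_le (hm : 0 < m) {φ : Fin m → ℝ} (hφ : ∀ i, 0 ≤ φ i)
    (hsum : ∑ i, φ i = m) {y : Fin m → Vec d} {Y : ℝ}
    (hY : ∀ i j, (m : ℝ) * ‖y i - y j‖ ^ 2 ≤ Y) (i : Fin m) :
    ‖(1 / (m : ℝ)) • ∑ j, φ j • y j - y i‖ ^ 2 ≤ Y / m := by
  have hm0 : (0 : ℝ) < m := by exact_mod_cast hm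
  have hY0 : 0 ≤ Y := by simpa using hY i i
  have h := norm_weighted_sub_le (spreadLE_of_sq hm hY) one_pos (p := fun j => φ j / m)
    (q := fun j => if j = i then 1 else 0) (fun j => div_nonneg (hφ j) hm0.le)
    (fun j => by positivity) (by rw [← Finset.sum_div, hsum, div_self hm0.ne']) (by simp)
  have e : (1 / (m : ℝ)) • ∑ j, φ j • y j = ∑ j, (φ j / m) • y j := by
    rw [Finset.smul_sum]
    refine Finset.sum_congr rfl fun j _ => ?_
    rw [smul_smul]; congr 1; ring
  rw [e]
  have h2 : ‖∑ j, (φ j / m) • y j - y i‖ ≤ √(Y / m) := by simpa using h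
  calc _ ≤ √(Y / m) ^ 2 := by gcongr
    _ = _ := Real.sq_sqrt (by positivity)

/-- The change of the iterates between two rounds. -/
lemma sum_norm_mix_add_sub_sq_le (hm : 0 < m) {M : Matrix (Fin m) (Fin m) ℝ}
    (hM : RowStochastic M) {x e : Fin m → Vec d} {X : ℝ}
    (hX : ∀ i j, (m : ℝ) * ‖x i - x j‖ ^ 2 ≤ X) :
    ∑ i, ‖mix M (x + e) i - x i‖ ^ 2 ≤ 2 * X + 2 * (m * ∑ i, ‖e i‖ ^ 2) := by
  have hm0 : (0 : ℝ) < m := by exact_mod_cast hm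
  have h : ∀ i, ‖mix M (x + e) i - x i‖ ^ 2 ≤ 2 * (X / m) + 2 * ∑ i, ‖e i‖ ^ 2 := fun i => by
    have hX0 : 0 ≤ X := by simpa using hX i i
    have h1 := norm_mix_sub_le (spreadLE_of_sq hm hX) hM i
    have h2 : ‖mix M x i - x i‖ ^ 2 ≤ X / m := by
      calc _ ≤ √(X / m) ^ 2 := by gcongr
        _ = _ := Real.sq_sqrt (by positivity)
    have h3 := norm_mix_sq_le hM e i
    have h4 : mix M (x + e) i - x i = (mix M x i - x i) + mix M e i := by
      rw [mix_add, Pi.add_apply]; abel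
    have h5 : ‖mix M (x + e) i - x i‖ ^ 2 ≤ (‖mix M x i - x i‖ + ‖mix M e i‖) ^ 2 := by
      rw [h4]; gcongr; exact norm_add_le _ _
    nlinarith [sq_nonneg (‖mix M x i - x i‖ - ‖mix M e i‖)]
  calc _ ≤ ∑ _i : Fin m, (2 * (X / m) + 2 * ∑ i, ‖e i‖ ^ 2) := Finset.sum_le_sum fun i _ => h i
    _ = _ := by
      rw [Finset.sum_const, Finset.card_univ, Fintype.card_fin, nsmul_eq_mul]
      field_simp

lemma sum_sum_norm_sub_sq_le (x : Fin m → Vec d) (xs : Vec d) :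
    ∑ i, ∑ j, ‖x i - x j‖ ^ 2 ≤ 4 * m * ∑ i, ‖x i - xs‖ ^ 2 := by
  have h : ∀ i j, ‖x i - x j‖ ^ 2 ≤ 2 * ‖x i - xs‖ ^ 2 + 2 * ‖x j - xs‖ ^ 2 := fun i j => by
    have h1 : ‖x i - x j‖ ≤ ‖x i - xs‖ + ‖x j - xs‖ := by
      rw [← sub_sub_sub_cancel_right (x i) (x j) xs]
      exact norm_sub_le _ _
    have h2 : ‖x i - x j‖ ^ 2 ≤ (‖x i - xs‖ + ‖x j - xs‖) ^ 2 := by gcongr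
    nlinarith [sq_nonneg (‖x i - xs‖ - ‖x j - xs‖)]
  calc _ ≤ ∑ i, ∑ j, (2 * ‖x i - xs‖ ^ 2 + 2 * ‖x j - xs‖ ^ 2) :=
        Finset.sum_le_sum fun i _ => Finset.sum_le_sum fun j _ => h i j
    _ = _ := by
      simp only [Finset.sum_add_distrib, Finset.sum_const, Finset.card_univ, Fintype.card_fin,
        nsmul_eq_mul, ← Finset.mul_sum]
      ring

/-- The error of a gradient estimate, in terms of the disagreements of the iterates and of the
estimates. -/
lemma norm_sub_sq_le_of_disagreement (hm : 0 < m) {x : Fin m → Vec d} {i : Fin m} {v w y : Vec d}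
    {K X Y : ℝ} (hX : ∀ j, (m : ℝ) * ‖x i - x j‖ ^ 2 ≤ X) (hX0 : 0 ≤ X)
    (hv : ‖v - w‖ ^ 2 ≤ 1 / (m : ℝ) * ∑ j, K ^ 2 * ‖x i - x j‖ ^ 2) (hw : ‖w - y‖ ^ 2 ≤ Y / m) :
    ‖v - y‖ ^ 2 ≤ (8 * K ^ 2 * X + 2 * Y) / m := by
  have hm0 : (0 : ℝ) < m := by exact_mod_cast hm
  have h1 : 1 / (m : ℝ) * ∑ j, K ^ 2 * ‖x i - x j‖ ^ 2 ≤ K ^ 2 * X / m := by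
    calc _ ≤ 1 / (m : ℝ) * ∑ _j : Fin m, K ^ 2 * (X / m) := by
          gcongr with j
          rw [le_div_iff₀' hm0]
          exact hX j
      _ = _ := by
          rw [Finset.sum_const, Finset.card_univ, Fintype.card_fin, nsmul_eq_mul]
          field_simp
  have h4 : ‖v - y‖ ≤ ‖v - w‖ + ‖w - y‖ := norm_sub_le_norm_sub_add_norm_sub _ _ _
  have h5 : ‖v - y‖ ^ 2 ≤ (‖v - w‖ + ‖w - y‖) ^ 2 := by gcongr
  have h6 : 0 ≤ K ^ 2 * X / m := by positivity
  have h7 : (8 * K ^ 2 * X + 2 * Y) / m = 8 * (K ^ 2 * X / m) + 2 * (Y / m) := by ring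
  rw [h7]
  linarith [sq_nonneg (‖v - w‖ - ‖w - y‖), add_sq ‖v - w‖ ‖w - y‖, sub_sq ‖v - w‖ ‖w - y‖]

end Aggregation

namespace IsRun

variable {m d : ℕ} {P : Problem m d} {L : ℝ} {c : Consts m} {ft : Fin m → Vec d → Vec d → ℝ}
  {Lt : Fin m → ℝ≥0} {C : ℕ → Matrix (Fin m) (Fin m) ℝ} {α : ℝ} {T : Trajectory m d}

/-- Contraction of the optimality gap of one agent by its local step, up to the error of its
estimate of the gradient of `F`. -/
lemma gap_half_le (hT : IsRun P ft C α T) (hP : P.Regular c.mu L)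
    (hft : P.Surrogate ft Lt c.mus) (hD : P.HessGap ft c.Dl c.Du) (hα : 0 < α) (hα1 : α < 1)
    (hcurv : 0 < c.curv α) {xs : Vec d} {Gs : ℝ} (hxs : xs ∈ P.K)
    (hlim : ∀ (p z : Vec d) (b : ℝ), (∀ w ∈ P.K, 0 ≤ ⟪p, w - z⟫_ℝ + (P.G w - b)) →
      0 ≤ ⟪p, xs - z⟫_ℝ + (Gs - b)) {ν : ℕ} {i : Fin m} (hx : T.x ν i ∈ P.K) :
    P.U (T.xhalf ν i) - (P.F xs + Gs) ≤
      (1 - α * (c.mu * c.curv α / (c.mu * c.curv α + 2 * c.Dmax ^ 2)))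
        * (P.U (T.x ν i) - (P.F xs + Gs))
      + α * (c.mu * c.curv α / (c.mu * c.curv α + 2 * c.Dmax ^ 2)) * c.GP α
        * ‖gradient P.F (T.x ν i) - T.y ν i‖ ^ 2 := by
  have hz := hT.xhat_mem ν i
  have hvi := fun w (hw : w ∈ P.K) => hT.variational hP hft hx hw
  have h1 := descent_step hP.G_convex ((hft.firstOrderLB hP i hx).mono (c.musMin_le i))
    ((hft.firstOrderLB_sub hP hD i hx).mono (c.DlMin_le i)) hx hz hvi hα.le hα1
  have h2 := gap_step hP.mu_pos hP.firstOrderLB_F hxs hz (hlim _ _ _ hvi)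
    (hft.lipschitz_sub hP hD i (c.Dmax_ge i) hx hz hx)
  have h3 := (strongConvexOn_zero.1
    ((hP.firstOrderLB_F.mono hP.mu_pos.le).strongConvexOn hP.K_convex)).2 hx hz
    (sub_nonneg.2 hα1.le) hα.le (sub_add_cancel 1 α)
  have h4 := hP.G_convex.2 hx hz (sub_nonneg.2 hα1.le) hα.le (sub_add_cancel 1 α)
  have he : (1 - α) • T.x ν i + α • T.xhat ν i = T.xhalf ν i := by
    rw [hT.xhalf_eq]; module
  rw [he] at h3 h4
  rw [← hT.xhalf_eq] at h1
  have h5 := real_inner_le_norm (gradient P.F (T.x ν i) - T.y ν i) (T.xhat ν i - T.x ν i)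
  simp only [smul_eq_mul] at h3 h4
  refine contraction_of_descent (e := ‖T.xhat ν i - T.x ν i‖) hα hP.mu_pos hcurv ?_ ?_
  · have h6 := mul_le_mul_of_nonneg_left h5 hα.le
    unfold Problem.U Consts.curv
    linarith
  · have h6 := mul_le_mul_of_nonneg_left h2 hα.le
    unfold Problem.U
    linarith

/-- The local steps are controlled by the optimality gaps and the disagreement of the gradient
estimates. -/
lemma sum_norm_direction_sq_le (hT : IsRun P ft C α T) (hm : 0 < m) (hP : P.Regular c.mu L)
    (hft : P.Surrogate ft Lt c.mus) (hD : P.HessGap ft c.Dl c.Du)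
    (hs : 0 < c.musMin) (hphi : 0 < c.philb) {xs : Vec d} {Gs : ℝ} (hxs : xs ∈ P.K)
    (hopt : ∀ w ∈ P.K, 0 ≤ ⟪gradient P.F xs, w - xs⟫_ℝ + (P.G w - Gs))
    (hlim : ∀ (p z : Vec d) (b : ℝ), (∀ w ∈ P.K, 0 ≤ ⟪p, w - z⟫_ℝ + (P.G w - b)) →
      0 ≤ ⟪p, xs - z⟫_ℝ + (Gs - b)) {ν : ℕ} (hx : ∀ i, T.x ν i ∈ P.K)
    (hlb : ∀ i, c.philb ≤ T.phi ν i) {ybar : Vec d} {Y : ℝ}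
    (hgrad : ∀ i, ‖gradient P.F (T.x ν i) - ybar‖ ^ 2
      ≤ 1 / (m : ℝ) * ∑ j, c.Lmax ^ 2 * ‖T.x ν i - T.x ν j‖ ^ 2)
    (hY0 : 0 ≤ Y) (hY : ∀ i, ‖ybar - T.y ν i‖ ^ 2 ≤ Y / m) :
    ∑ i, ‖T.xhat ν i - T.x ν i‖ ^ 2 ≤
      c.C1 * ∑ i, T.phi ν i * (P.U (T.x ν i) - (P.F xs + Gs)) + c.C2 * Y := by
  have hm0 : (0 : ℝ) < m := by exact_mod_cast hm
  have hmu := hP.mu_pos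
  set M := c.musMin with hM
  set R := c.Dmax / M + 1 with hR
  have h1 : ∀ i, ‖T.xhat ν i - T.x ν i‖ ^ 2 ≤ 3 * R ^ 2 * ‖T.x ν i - xs‖ ^ 2
      + 3 / M ^ 2 * ‖gradient P.F (T.x ν i) - ybar‖ ^ 2 + 3 / M ^ 2 * (Y / m) := fun i => by
    have hz := hT.xhat_mem ν i
    have h2 := dist_step hs ((hft.firstOrderLB hP i (hx i)).mono (c.musMin_le i)) hxs hz
      (hlim _ _ _ fun w hw => hT.variational hP hft (hx i) hw) (hopt _ hz)
      (hft.lipschitz_sub hP hD i (c.Dmax_ge i) hxs (hx i) (hx i))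
    have h3 : ‖gradient P.F (T.x ν i) - T.y ν i‖
        ≤ ‖gradient P.F (T.x ν i) - ybar‖ + ‖ybar - T.y ν i‖ :=
      norm_sub_le_norm_sub_add_norm_sub _ _ _
    have h4 : ‖T.xhat ν i - T.x ν i‖ ≤ R * ‖T.x ν i - xs‖
        + ‖gradient P.F (T.x ν i) - ybar‖ / M + ‖ybar - T.y ν i‖ / M := by
      have h5 := div_le_div_of_nonneg_right h3 hs.le
      rw [add_div] at h5
      linarith
    have h5 : ‖T.xhat ν i - T.x ν i‖ ^ 2 ≤ (R * ‖T.x ν i - xs‖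
        + ‖gradient P.F (T.x ν i) - ybar‖ / M + ‖ybar - T.y ν i‖ / M) ^ 2 := by gcongr
    have h6 : ∀ r s t : ℝ, (r + s + t) ^ 2 ≤ 3 * r ^ 2 + 3 * s ^ 2 + 3 * t ^ 2 := fun r s t => by
      nlinarith [sq_nonneg (r - s), sq_nonneg (s - t), sq_nonneg (r - t)]
    refine (h5.trans (h6 _ _ _)).trans ?_
    have h7 : 3 / M ^ 2 * ‖ybar - T.y ν i‖ ^ 2 ≤ 3 / M ^ 2 * (Y / m) := by gcongr; exact hY i
    rw [mul_pow, div_pow, div_pow]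
    linear_combination h7
  set e := ∑ i, ‖T.x ν i - xs‖ ^ 2 with he
  have h2 : ∑ i, ‖gradient P.F (T.x ν i) - ybar‖ ^ 2 ≤ 4 * c.Lmax ^ 2 * e := by
    calc _ ≤ ∑ i, 1 / (m : ℝ) * ∑ j, c.Lmax ^ 2 * ‖T.x ν i - T.x ν j‖ ^ 2 :=
          Finset.sum_le_sum fun i _ => hgrad i
      _ = c.Lmax ^ 2 / m * ∑ i, ∑ j, ‖T.x ν i - T.x ν j‖ ^ 2 := by
          simp only [← Finset.mul_sum]; ring
      _ ≤ c.Lmax ^ 2 / m * (4 * m * e) := by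
          gcongr; exact sum_sum_norm_sub_sq_le _ _
      _ = _ := by field_simp
  have h3 : ∑ i, ‖T.xhat ν i - T.x ν i‖ ^ 2
      ≤ 3 * (R ^ 2 + 4 * c.Lmax ^ 2 / M ^ 2) * e + 3 / M ^ 2 * Y := by
    calc _ ≤ ∑ i, (3 * R ^ 2 * ‖T.x ν i - xs‖ ^ 2
          + 3 / M ^ 2 * ‖gradient P.F (T.x ν i) - ybar‖ ^ 2 + 3 / M ^ 2 * (Y / m)) :=
          Finset.sum_le_sum fun i _ => h1 i
      _ = 3 * R ^ 2 * e + 3 / M ^ 2 * ∑ i, ‖gradient P.F (T.x ν i) - ybar‖ ^ 2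
          + 3 / M ^ 2 * Y := by
          simp only [Finset.sum_add_distrib, ← Finset.mul_sum, Finset.sum_const, Finset.card_univ,
            Fintype.card_fin, nsmul_eq_mul, ← he]
          field_simp
      _ ≤ 3 * R ^ 2 * e + 3 / M ^ 2 * (4 * c.Lmax ^ 2 * e) + 3 / M ^ 2 * Y := by gcongr
      _ = _ := by ring
  have h4 : c.philb * (c.mu / 2) * e
      ≤ ∑ i, T.phi ν i * (P.U (T.x ν i) - (P.F xs + Gs)) := by
    rw [he, Finset.mul_sum]
    refine Finset.sum_le_sum fun i _ => ?_
    have h5 := hP.firstOrderLB_F xs hxs _ (hx i)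
    have h6 := hopt _ (hx i)
    have h7 : c.mu / 2 * ‖T.x ν i - xs‖ ^ 2 ≤ P.U (T.x ν i) - (P.F xs + Gs) := by
      unfold Problem.U; linarith
    rw [mul_assoc]
    exact mul_le_mul (hlb i) h7 (by positivity) (hphi.le.trans (hlb i))
  refine h3.trans (add_le_add ?_ ?_)
  · calc _ = c.C1 * (c.philb * (c.mu / 2) * e) := by
          unfold Consts.C1; rw [← hM, ← hR]; field_simp; ring
      _ ≤ _ := by
          refine mul_le_mul_of_nonneg_left h4 ?_
          unfold Consts.C1; positivity
  · unfold Consts.C2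
    gcongr
    norm_num

/-- Averaging does not increase the weighted optimality gap. -/
lemma sum_phi_gap_succ_le (hT : IsRun P ft C α T) {E : ℕ → Fin m → Fin m → Prop} {cl : ℝ}
    (hC : Weights E C cl) (hU : ConvexOn ℝ P.K P.U) (hpos : ∀ ν i, 0 < T.phi ν i) {ν : ℕ}
    (hW : RowStochastic (rowWeights C T.phi ν)) (hx : ∀ i, T.xhalf ν i ∈ P.K) (u : ℝ) :
    ∑ i, T.phi (ν + 1) i * (P.U (T.x (ν + 1) i) - u)
      ≤ ∑ j, T.phi ν j * (P.U (T.xhalf ν j) - u) := by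
  have h1 : ∀ i, T.phi (ν + 1) i * (P.U (T.x (ν + 1) i) - u)
      ≤ ∑ j, C ν i j • (T.phi ν j * (P.U (T.xhalf ν j) - u)) := fun i => by
    have h2 := hU.map_sum_le (t := Finset.univ) (p := T.xhalf ν)
      (w := rowWeights C T.phi ν i) (fun j _ => hW.nonneg i j) (hW.row_sum i) fun j _ => hx j
    have h3 : T.x (ν + 1) i = ∑ j, rowWeights C T.phi ν i j • T.xhalf ν j := by
      rw [hT.x_succ_eq]; rfl
    rw [← h3] at h2
    have h4 : P.U (T.x (ν + 1) i) - u
        ≤ ∑ j, rowWeights C T.phi ν i j * (P.U (T.xhalf ν j) - u) := by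
      simp only [mul_sub, Finset.sum_sub_distrib, ← Finset.sum_mul, hW.row_sum i, one_mul]
      exact sub_le_sub_right h2 _
    refine (mul_le_mul_of_nonneg_left h4 (hpos _ i).le).trans (le_of_eq ?_)
    rw [Finset.mul_sum]
    refine Finset.sum_congr rfl fun j _ => ?_
    have := (hpos (ν + 1) i).ne'
    rw [rowWeights, smul_eq_mul]
    field_simp
  exact (Finset.sum_le_sum fun i _ => h1 i).trans (le_of_eq (hC.sum_smul ν _))

end IsRun

/-- The form of `A_{1/2}` in which it arises from the loop of recursions. -/
lemma Consts.A_half_sq {m : ℕ} (c : Consts m) (hρ : c.rhoB < 1) (hphi : 0 ≤ c.phiub)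
    (hG : 0 ≤ c.GPcap) (hC1 : 0 ≤ c.C1) (hC2 : 0 ≤ c.C2) {q k : ℝ}
    (hq : q = c.c0 ^ 2 * c.rhoB ^ 2 / (1 - c.rhoB)) (hk : k = (c.philb ^ 2)⁻¹ * c.Lmax ^ 2) :
    c.A (1 / 2) ^ 2 = (c.GPcap * 2) * c.C1 * (8 * c.phiub * c.Lmax ^ 2) * (2 * q)
      + ((c.GPcap * 2) * (2 * c.phiub) * c.C1 + c.C2) * (2 * m * k) * (2 * q)
      + ((c.GPcap * 2) * (2 * c.phiub) * c.C1 + c.C2) * (8 * m * k) * (4 * q ^ 2) := by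
  have h1 : c.A1 (1 / 2) + c.A2 (1 / 2) + c.A3 (1 / 2)
      = (c.GPcap * 2) * c.C1 * (8 * c.phiub * c.Lmax ^ 2) * (2 * q)
      + ((c.GPcap * 2) * (2 * c.phiub) * c.C1 + c.C2) * (2 * m * k) * (2 * q)
      + ((c.GPcap * 2) * (2 * c.phiub) * c.C1 + c.C2) * (8 * m * k) * (4 * q ^ 2) := by
    have e1 : 2 * c.c0 ^ 2 * c.rhoB ^ 2 / (1 - c.rhoB) = 2 * q := by rw [hq]; ring
    have e2 : 4 * c.c0 ^ 4 * c.rhoB ^ 4 / (1 - c.rhoB) ^ 2 = 4 * q ^ 2 := by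
      rw [hq, div_pow, ← mul_div_assoc]; congr 1; ring
    unfold A1 A2 A3
    rw [e1, e2, hk, one_div, inv_inv]
    ring
  have hq0 : 0 ≤ q := by
    have : 0 < 1 - c.rhoB := sub_pos.2 hρ
    rw [hq]; positivity
  have hk0 : 0 ≤ k := by rw [hk]; positivity
  rw [A, Real.sq_sqrt (by rw [h1]; positivity), h1]

end SONATA

open SONATA

theorem theoremI5 {m d : ℕ} (hm : 2 ≤ m)
    (P : SONATA.Problem m d) (c : SONATA.Consts m) (L : ℝ)
    (hP : P.Regular c.mu L) (hLs : P.SmoothConsts c.Ls)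
    (ft : Fin m → SONATA.Vec d → SONATA.Vec d → ℝ) (Lt : Fin m → NNReal)
    (hft : P.Surrogate ft Lt c.mus) (hD : P.HessGap ft c.Dl c.Du)
    (E : ℕ → Fin m → Fin m → Prop) (hE : SONATA.StronglyConnected E c.B)
    (C : ℕ → Matrix (Fin m) (Fin m) ℝ) (hC : SONATA.Weights E C c.cl)
    (hmu : c.DlMin ≤ c.musMin)
    (α : ℝ) (hα : 0 < α) (hα_max : α < c.alphaMax)
    (T : SONATA.Trajectory m d) (hT : SONATA.IsRun P ft C α T) :
    0 < c.rate α ∧ c.rate α < 1 ∧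
      ∀ i : Fin m,
        (fun ν : ℕ => P.U (T.x ν i) - P.Ustar) =O[Filter.atTop] (fun ν : ℕ => c.rate α ^ ν) := by
  have hm1 : 0 < m := by omega
  have hm0 : (0 : ℝ) < m := by exact_mod_cast hm1
  let i₀ : Fin m := ⟨0, hm1⟩
  have hmu0 : 0 < c.mu := hP.mu_pos
  have hs : 0 < c.musMin := c.musMin_pos i₀ hft.mus_pos
  have hL : 0 < c.Lmax := (hLs i₀).1.trans_le (c.Lmax_ge i₀)
  have hcl0 := hC.cl_pos
  have hcl1 := hC.cl_le_one i₀
  have hB : 0 < c.B := hE.1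
  obtain ⟨hε0, hε1⟩ := c.clt_pow_bounds hm hB hcl0 hcl1
  obtain ⟨hρ0, hρ1, hρN⟩ := c.rhoB_spec hm hB hcl0 hcl1
  have hc0 := c.le_c0_sq hm hB hcl0 hcl1
  obtain ⟨-, hα1, hα2⟩ := c.alphaMax_bounds hα_max
  obtain ⟨hA, hz1, hzJ, hzA⟩ := c.rate_spec hρ1 hs hmu0 hα hα_max
  obtain ⟨hcurv, hGP⟩ := c.curv_bounds hs hmu0 hmu hα2
  have hcurv0 : 0 < c.curv α := by linarith
  set z := c.rate α with hzdef
  have hzρ : c.rhoB < z := by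
    have : 0 < c.A (1 / 2) * α := by positivity
    linarith
  have hz0 : 0 < z := hρ0.trans hzρ
  refine ⟨hz0, hz1, ?_⟩
  -- the weights `φ` and the row stochastic matrices
  have hphi0 : 0 < c.philb := pow_pos hcl0 _
  have hlb : ∀ ν i, c.philb ≤ T.phi ν i := phi_lower hC hT.phi_init hT.phi_succ hE hm
  have hub : ∀ ν i, T.phi ν i ≤ c.phiub := phi_upper hC hT.phi_init hT.phi_succ hE hm
  have hpos : ∀ ν i, 0 < T.phi ν i := fun ν i => hphi0.trans_le (hlb ν i)
  have hphiub0 : 0 < c.phiub := (hpos 0 i₀).trans_le (hub 0 i₀)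
  have hsum : ∀ ν, ∑ i, T.phi ν i = m := phi_sum hC hT.phi_init hT.phi_succ
  have hW := rowWeights_rowStochastic hC hT.phi_succ hpos
  have hWc := rowWeights_compatible hC hT.phi_init hT.phi_succ hE hm
  have hxK := hT.x_mem hP hα.le hα1.le hW
  -- consensus bounds
  set κ := ((1 - c.clt ^ ((m - 1) * c.B)) ^ 2)⁻¹ with hκ
  have hκ0 : 0 ≤ κ := by positivity
  have hmix : ∀ (s n : ℕ) (a : Fin m → Vec d) (r : ℝ), 0 ≤ r → SpreadLE a r →
      SpreadLE (mix (backProd (rowWeights C T.phi) s n) a) (κ * c.rhoB ^ n * r) :=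
    fun s n a r hr ha => hWc.spreadLE_backProd hW hE hm hρ0 hρ1.le hρN s n hr ha
  set q := c.c0 ^ 2 * c.rhoB ^ 2 / (1 - c.rhoB) with hq
  have hc0pos : 0 < c.c0 ^ 2 := by
    refine lt_of_lt_of_le ?_ hc0
    have : 0 < 1 - c.clt ^ ((m - 1) * c.B) := by linarith
    positivity
  have hρ' : 0 < 1 - c.rhoB := sub_pos.2 hρ1
  have hq0 : 0 < q := by positivity
  have hκq : 2 * m * κ ^ 2 * c.rhoB ^ 2 / (1 - c.rhoB) ≤ q := by rw [hq]; gcongr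
  obtain ⟨X, hX0, hX, hXrec⟩ := exists_consensus_bound hρ0 hρ1 hκ0 hmix
    (a := T.x) (b := fun ν i => α • (T.xhat ν i - T.x ν i))
    (fun ν => by rw [hT.x_succ_eq, hT.xhalf_eq_add])
  obtain ⟨Y, hY0, hY, hYrec⟩ := exists_consensus_bound hρ0 hρ1 hκ0 hmix
    (a := T.y) (b := fun ν j => (1 / T.phi ν j) •
      (gradient (P.f j) (T.x (ν + 1) j) - gradient (P.f j) (T.x ν j)))
    (hT.y_succ_eq hpos)
  set S : ℕ → ℝ := fun ν => ∑ i, ‖T.xhat ν i - T.x ν i‖ ^ 2 with hSdef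
  have hS0 : ∀ ν, 0 ≤ S ν := fun ν => Finset.sum_nonneg fun i _ => by positivity
  have hpert : ∀ ν, ∑ i, ‖α • (T.xhat ν i - T.x ν i)‖ ^ 2 = α ^ 2 * S ν := fun ν => by
    rw [hSdef, Finset.mul_sum]
    refine Finset.sum_congr rfl fun i _ => ?_
    rw [norm_smul, mul_pow, Real.norm_of_nonneg hα.le]
  have hflip : ∀ j, ∀ x ∈ P.K, ∀ y ∈ P.K,
      ‖gradient (P.f j) y - gradient (P.f j) x‖ ≤ c.Lmax * ‖y - x‖ := fun j x hx y hy =>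
    (hP.lipschitz_f hLs j hx hy).trans
      (mul_le_mul_of_nonneg_right (c.Lmax_ge j) (norm_nonneg _))
  have hX' : ∀ ν, X (ν + 1) ≤ c.rhoB * X ν + q * (α ^ 2 * S ν) := fun ν => by
    refine (hXrec ν).trans ?_
    rw [hpert]
    have := hS0 ν
    gcongr
  set k := (c.philb ^ 2)⁻¹ * c.Lmax ^ 2 with hk
  have hk0 : 0 < k := by positivity
  have hY' : ∀ ν, Y (ν + 1) ≤ c.rhoB * Y ν
      + q * (k * (2 * X ν + 2 * α ^ 2 * m * S ν)) := fun ν => by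
    refine (hYrec ν).trans ?_
    have h1 : ∑ j, ‖(1 / T.phi ν j) •
        (gradient (P.f j) (T.x (ν + 1) j) - gradient (P.f j) (T.x ν j))‖ ^ 2
        ≤ k * ∑ j, ‖T.x (ν + 1) j - T.x ν j‖ ^ 2 := by
      rw [Finset.mul_sum]
      refine Finset.sum_le_sum fun j _ => ?_
      have hp := hpos ν j
      rw [norm_smul, mul_pow, Real.norm_of_nonneg (by positivity), hk, mul_assoc, one_div, inv_pow,
        ← mul_pow]
      have h3 := hflip j _ (hxK ν j) _ (hxK (ν + 1) j)
      have h4 := hlb ν j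
      gcongr
    have h2 := sum_norm_mix_add_sub_sq_le hm1 (hW ν)
      (e := fun i => α • (T.xhat ν i - T.x ν i)) (hX ν)
    rw [← hT.xhalf_eq_add, ← hT.x_succ_eq, hpert] at h2
    have h3 : ∑ j, ‖(1 / T.phi ν j) •
        (gradient (P.f j) (T.x (ν + 1) j) - gradient (P.f j) (T.x ν j))‖ ^ 2
        ≤ k * (2 * X ν + 2 * α ^ 2 * m * S ν) :=
      h1.trans (mul_le_mul_of_nonneg_left (h2.trans (le_of_eq (by ring))) hk0.le)
    gcongr
  -- the limit of the minimizing sequences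
  have hbdd : BddBelow ((fun x => P.F x + P.G x) '' P.K) :=
    bddBelow_of_minorant hmu0 hP.firstOrderLB_F (hT.xhat_mem 0 i₀)
      fun w hw => hT.variational hP hft (hxK 0 i₀) hw
  obtain ⟨xs, hxs, Gs, hUs, hopt, hlim⟩ := exists_limit_minimizer hP.K_nonempty hP.K_closed hmu0
    hP.firstOrderLB_F (fun x hx => hP.hasGradientAt_F (hP.K_subset_O hx)) hP.G_convex hbdd
  have hUstar : P.Ustar = P.F xs + Gs := hUs.symm
  have hu0 : ∀ w ∈ P.K, 0 ≤ P.U w - (P.F xs + Gs) := fun w hw => by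
    rw [hUs]; exact sub_nonneg.2 (csInf_le hbdd ⟨w, hw, rfl⟩)
  -- errors of the gradient estimates
  set ybar : ℕ → Vec d := fun ν => (1 / (m : ℝ)) • ∑ j, gradient (P.f j) (T.x ν j) with hybar
  have hgrad : ∀ ν i, ‖gradient P.F (T.x ν i) - ybar ν‖ ^ 2
      ≤ 1 / (m : ℝ) * ∑ j, c.Lmax ^ 2 * ‖T.x ν i - T.x ν j‖ ^ 2 := fun ν i => by
    rw [hP.gradient_F (hP.K_subset_O (hxK ν i)), hybar, ← smul_sub, ← Finset.sum_sub_distrib]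
    refine (norm_mean_sq_le hm1 _).trans ?_
    gcongr with j
    rw [← mul_pow]
    have := hflip j _ (hxK ν j) _ (hxK ν i)
    gcongr
  have hyb : ∀ ν i, ‖ybar ν - T.y ν i‖ ^ 2 ≤ Y ν / m := fun ν i => by
    change ‖(1 / (m : ℝ)) • ∑ j, gradient (P.f j) (T.x ν j) - T.y ν i‖ ^ 2 ≤ Y ν / m
    rw [← hT.sum_phi_smul_y hC hpos]
    exact norm_weighted_mean_sub_sq_le hm1 (fun j => (hpos ν j).le) (hsum ν) (hY ν) i
  have hδ : ∀ ν i, ‖gradient P.F (T.x ν i) - T.y ν i‖ ^ 2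
      ≤ (8 * c.Lmax ^ 2 * X ν + 2 * Y ν) / m := fun ν i =>
    norm_sub_sq_le_of_disagreement hm1 (hX ν i) (hX0 ν) (hgrad ν i) (hyb ν i)
  -- the averaged optimality gap
  set p : ℕ → ℝ := fun ν => ∑ i, T.phi ν i * (P.U (T.x ν i) - (P.F xs + Gs)) with hpdef
  set τ := c.mu * c.curv α / (c.mu * c.curv α + 2 * c.Dmax ^ 2) with hτ
  have hτ0 : 0 ≤ τ := by positivity
  have hτ1 : τ ≤ 1 := by
    rw [hτ, div_le_one (by positivity)]
    exact le_add_of_nonneg_right (by positivity)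
  have hGP0 : 0 < c.GP α := by unfold Consts.GP; positivity
  have hGPcap0 : 0 < c.GPcap := hGP0.trans_le hGP
  have hUconv : ConvexOn ℝ P.K P.U :=
    (strongConvexOn_zero.1
      ((hP.firstOrderLB_F.mono hmu0.le).strongConvexOn hP.K_convex)).add hP.G_convex
  have hp' : ∀ ν, p (ν + 1) ≤ (1 - α * τ) * p ν + α * τ * c.GP α *
      (8 * c.phiub * c.Lmax ^ 2 * X ν + 2 * c.phiub * Y ν) := fun ν => by
    calc p (ν + 1) ≤ ∑ j, T.phi ν j * (P.U (T.xhalf ν j) - (P.F xs + Gs)) :=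
          hT.sum_phi_gap_succ_le hC hUconv hpos (hW ν)
            (hT.xhalf_mem hP hα.le hα1.le (hxK ν)) _
      _ ≤ ∑ j, ((1 - α * τ) * (T.phi ν j * (P.U (T.x ν j) - (P.F xs + Gs)))
          + α * τ * c.GP α * (c.phiub * ((8 * c.Lmax ^ 2 * X ν + 2 * Y ν) / m))) := by
        refine Finset.sum_le_sum fun j _ => ?_
        have h2 := mul_le_mul_of_nonneg_left
          (hT.gap_half_le hP hft hD hα hα1 hcurv0 hxs hlim (hxK ν j)) (hpos ν j).le
        rw [← hτ] at h2
        have h3 : T.phi ν j * ‖gradient P.F (T.x ν j) - T.y ν j‖ ^ 2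
            ≤ c.phiub * ((8 * c.Lmax ^ 2 * X ν + 2 * Y ν) / m) :=
          mul_le_mul (hub ν j) (hδ ν j) (by positivity) hphiub0.le
        have h4 := mul_le_mul_of_nonneg_left h3 (by positivity : 0 ≤ α * τ * c.GP α)
        linear_combination h2 + h4
      _ = _ := by
        rw [Finset.sum_add_distrib, ← Finset.mul_sum, Finset.sum_const, Finset.card_univ,
          Fintype.card_fin, nsmul_eq_mul, hpdef]
        field_simp
  have hS' : ∀ ν, S ν ≤ c.C1 * p ν + c.C2 * Y ν := fun ν =>
    hT.sum_norm_direction_sq_le hm1 hP hft hD hs hphi0 hxs hopt hlim (hxK ν) (hlb ν) (hgrad ν)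
      (hY0 ν) (hyb ν)
  have hC1 : 0 ≤ c.C1 := by unfold Consts.C1; positivity
  have hC2 : 0 ≤ c.C2 := by unfold Consts.C2; positivity
  -- the gain of the optimization step at `z` is at most `2 GPcap`, since `z ≥ 1 - α τ / 2`
  have hη : α * τ * c.GP α ≤ (c.GPcap * 2) * (z - (1 - α * τ)) := by
    have h1 := mul_le_mul_of_nonneg_left (c.two_J_le hs hmu0 hcurv) hα.le
    rw [← hτ] at h1
    have h2 : α * τ ≤ 2 * (z - (1 - α * τ)) := by linear_combination 2 * hzJ + h1
    have h3 : α * τ * c.GP α ≤ α * τ * c.GPcap := by gcongr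
    have h4 := mul_le_mul_of_nonneg_left h2 hGPcap0.le
    linear_combination h3 + h4
  have hσ : 0 ≤ 1 - α * τ := sub_nonneg.2 (mul_le_one₀ hα1.le hτ0 hτ1)
  have hgain : α ^ 2 * ((c.GPcap * 2) * c.C1 * (8 * c.phiub * c.Lmax ^ 2) * (2 * q)
      + ((c.GPcap * 2) * (2 * c.phiub) * c.C1 + c.C2) * (2 * m * k) * (2 * q)
      + ((c.GPcap * 2) * (2 * c.phiub) * c.C1 + c.C2) * (8 * m * k) * (4 * q ^ 2))
      ≤ (z - c.rhoB) ^ 2 := by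
    rw [← c.A_half_sq hρ1 hphiub0.le hGPcap0.le hC1 hC2 hq hk, ← mul_pow]
    have h3 : 0 ≤ α * c.A (1 / 2) := by positivity
    gcongr
    linear_combination hzA
  obtain ⟨M, hM0, hM⟩ := geometric_of_small_gain hσ (by positivity) hα hρ0.le hzρ hz1.le hq0 hk0
    (by exact_mod_cast hm1 : (1 : ℝ) ≤ m) (by positivity) (by positivity) hC1 hC2 (by positivity)
    hη hp' hX' hY' hS' hgain
  intro i
  refine IsBigO.of_bound (M / c.philb) (Eventually.of_forall fun ν => ?_)
  rw [hUstar, Real.norm_of_nonneg (hu0 _ (hxK ν i)), Real.norm_of_nonneg (by positivity),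
    div_mul_eq_mul_div, le_div_iff₀' hphi0]
  calc c.philb * (P.U (T.x ν i) - (P.F xs + Gs))
      ≤ T.phi ν i * (P.U (T.x ν i) - (P.F xs + Gs)) :=
        mul_le_mul_of_nonneg_right (hlb ν i) (hu0 _ (hxK ν i))
    _ ≤ p ν := Finset.single_le_sum
        (f := fun i => T.phi ν i * (P.U (T.x ν i) - (P.F xs + Gs)))
        (fun j _ => mul_nonneg (hpos ν j).le (hu0 _ (hxK ν j))) (Finset.mem_univ i)
    _ ≤ M * z ^ ν := hM ν
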